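/- Let $\Bbbk\in\{\mathbb R,\mathbb C\}$, let $d\ge 0$, let $\mathbb D=\{x\in\mathbb R^d : \|x\|\le 1\}$ and $\mathbb D^\times=\mathbb D\setminus\{0\}$. Let $\pi:\mathcal E\to\mathbb D$ be a continuous (also called (F)) Banach bundle over $\Bbbk$: a continuous open surjection whose fibers $\mathcal E_x=\pi^{-1}(x)$ are Banach spaces, such that addition $\mathcal E\times_{\mathbb D}\mathcal E\to\mathcal E$, scaling $\Bbbk\times\mathcal E\to\mathcal E$ and the norm $\mathcal E\to\mathbb R$ are continuous, and such that for every $x\in\mathbb D$ the sets $\{v\in\pi^{-1}(U) : \|v\|<\varepsilon\}$, for $U\ni x$ open and $\varepsilon>0$, form a neighborhood basis of $0_x\in\mathcal E_x$. Assume that 1. $\mathcal E$ is subhomogeneous, i.e. its fibers are finite-dimensional with dimensions bounded by a common finite constant; 2. the dimension of $\mathcal E_x$ is the same for all $x\in\mathbb D^\times$, so that the fiber dimension can jump only at $0$; 3. $\mathcal E$ is of finite type over $\mathbb D^\times$, i.e. $\mathbb D^\times$ is the union of finitely many open subsets $U_i$ such that $\mathcal E|_{U_i}$ is homeomorphic over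 $U_i$, by a map linear on fibers, to $U_i\times\Bbbk^{n_i}$ for some $n_i$. Then $\mathcal E$ embeds into a trivial homogeneous bundle: there are $N\ge 0$ and a map $\mathcal E\to\mathbb D\times\Bbbk^N$ over $\mathbb D$, linear and injective on each fiber, that is a homeomorphism onto its image. -/

import Mathlib

open Topology

/- Bundles are given by a family of normed spaces `E : X → Type*` (the fibers) together with a
topology on the total space `Bundle.TotalSpace F E`, the disjoint union of the fibers.  As
everywhere in Mathlib, the type `F` is a mere label of the total space and carries no content. -/

/-- `E` is a *continuous* (or *(F)*) Banach bundle over `X`. The projection is automatically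
surjective, since every fiber contains `0`. -/
structure IsContinuousBanachBundle (𝕜 : Type*) [RCLike 𝕜] {X : Type*} [TopologicalSpace X]
    (F : Type*) (E : X → Type*) [∀ x, NormedAddCommGroup (E x)] [∀ x, NormedSpace 𝕜 (E x)]
    [TopologicalSpace (Bundle.TotalSpace F E)] : Prop where
  /-- the fibers are Banach spaces -/
  complete_fiber : ∀ x, CompleteSpace (E x)
  /-- the projection is continuous -/
  continuous_proj : Continuous (Bundle.TotalSpace.proj : Bundle.TotalSpace F E → X)
  /-- the projection is open -/
  isOpenMap_proj : IsOpenMap (Bundle.TotalSpace.proj : Bundle.TotalSpace F E → X)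
  /-- addition is continuous on the set of pairs of points in a common fiber, as a subspace of
  the square of the total space -/
  continuous_add : Continuous
    (fun p ↦ ⟨p.proj, p.snd.1 + p.snd.2⟩ :
      Bundle.TotalSpace (F × F) (fun x ↦ E x × E x) → Bundle.TotalSpace F E)
  /-- scaling is continuous -/
  continuous_smul : Continuous
    (fun p ↦ ⟨p.2.proj, p.1 • p.2.snd⟩ : 𝕜 × Bundle.TotalSpace F E → Bundle.TotalSpace F E)
  /-- the norm is a continuous function on the total space -/
  continuous_norm : Continuous (fun v ↦ ‖v.snd‖ : Bundle.TotalSpace F E → ℝ)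
  /-- the vectors of norm `< ε` over an open set `U ∋ x`, for variable `ε > 0` and `U`, form a
  neighborhood basis of the zero vector over `x` -/
  hasBasis_nhds_zero : ∀ x : X,
    (𝓝 (⟨x, 0⟩ : Bundle.TotalSpace F E)).HasBasis
      (fun p : Set X × ℝ ↦ IsOpen p.1 ∧ x ∈ p.1 ∧ 0 < p.2)
      (fun p ↦ {v | v.proj ∈ p.1 ∧ ‖v.snd‖ < p.2})

/-- The fibers are finite-dimensional, of globally bounded dimension. -/
def IsSubhomogeneous (𝕜 : Type*) [RCLike 𝕜] {X : Type*} (E : X → Type*)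
    [∀ x, NormedAddCommGroup (E x)] [∀ x, NormedSpace 𝕜 (E x)] : Prop :=
  ∃ N : ℕ, ∀ x, FiniteDimensional 𝕜 (E x) ∧ Module.finrank 𝕜 (E x) ≤ N

/-- Over the open set `U` the bundle can be identified, by a homeomorphism over `U` that is linear
(not necessarily isometric) on the fibers, with `U × 𝕜ⁿ` for some `n`. -/
def IsTrivializableOver (𝕜 : Type*) [RCLike 𝕜] {X : Type*} [TopologicalSpace X]
    (F : Type*) (E : X → Type*) [∀ x, NormedAddCommGroup (E x)] [∀ x, NormedSpace 𝕜 (E x)]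
    [TopologicalSpace (Bundle.TotalSpace F E)] (U : Set X) : Prop :=
  ∃ (n : ℕ) (e : Bundle.Trivialization (EuclideanSpace 𝕜 (Fin n))
      (Bundle.TotalSpace.proj : Bundle.TotalSpace F E → X)),
    e.baseSet = U ∧ ∀ x ∈ U, IsLinearMap 𝕜 fun v : E x ↦ (e ⟨x, v⟩).2

/-- The restriction of the bundle to the open set `S` is of *finite type*: `S` is covered by
finitely many open subsets of `S` over each of which the bundle is trivializable. -/
def IsFiniteTypeOver (𝕜 : Type*) [RCLike 𝕜] {X : Type*} [TopologicalSpace X]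
    (F : Type*) (E : X → Type*) [∀ x, NormedAddCommGroup (E x)] [∀ x, NormedSpace 𝕜 (E x)]
    [TopologicalSpace (Bundle.TotalSpace F E)] (S : Set X) : Prop :=
  ∃ (k : ℕ) (U : Fin k → Set X),
    (⋃ i, U i) = S ∧ ∀ i, IsOpen (U i) ∧ IsTrivializableOver 𝕜 F E (U i)

/-- An embedding of the bundle `E` into the bundle `E'` over the same base: a family of injective
linear maps between the fibers that is a homeomorphism of the total space of `E` onto its image
in the total space of `E'`. -/
def IsBundleEmbedding (𝕜 : Type*) [RCLike 𝕜] {X : Type*}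
    (F : Type*) (E : X → Type*) [∀ x, NormedAddCommGroup (E x)] [∀ x, NormedSpace 𝕜 (E x)]
    [TopologicalSpace (Bundle.TotalSpace F E)]
    (F' : Type*) (E' : X → Type*) [∀ x, NormedAddCommGroup (E' x)] [∀ x, NormedSpace 𝕜 (E' x)]
    [TopologicalSpace (Bundle.TotalSpace F' E')] (φ : ∀ x, E x →ₗ[𝕜] E' x) : Prop :=
  (∀ x, Function.Injective (φ x)) ∧
    IsEmbedding (fun v ↦ ⟨v.proj, φ v.proj v.snd⟩ :
      Bundle.TotalSpace F E → Bundle.TotalSpace F' E')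

/-- The closed unit ball `{x ∈ ℝᵈ : ‖x‖ ≤ 1}` for the Euclidean norm. -/
abbrev UnitBall (d : ℕ) : Type :=
  Metric.closedBall (0 : EuclideanSpace ℝ (Fin d)) 1

/-- The unit ball without its center. -/
def puncturedBall (d : ℕ) : Set (UnitBall d) :=
  {x | (x : EuclideanSpace ℝ (Fin d)) ≠ 0}

/-! Let `o` be the centre. Off `o` there are linear maps `ψ x : E x → H` into a fixed
finite-dimensional space, continuous in `x`, with `‖ψ x v‖` comparable to `‖v‖` by one constant. A
trivialization alone gives no such constant, as the fiber norms may degenerate in it near `o`. A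
continuous family of norms on `𝕜ⁿ` is therefore first straightened by a Gram–Schmidt process with
near-best approximations (`Seminorm.exists_continuous_uniform_coordinates`), and the charts are then
glued by a partition of unity (`exists_uniform_coordinates_of_isFiniteTypeOver`).

The family `ψ` need not converge at `o`. Its behaviour there is recorded by operators `A x : 𝕜ᵐ →
H`, continuous off `o`: with `b : 𝕜ᵐ ≃ E o`, vectors near `b c` have `ψ`-value close to `A x c`
(`exists_isAsymptoticValue`, `exists_asymptotic_linearMap`). Near `o` the `A x` are uniformly
bounded above and below, so the regularized inverses `R x = (A†A + dist x o)⁻¹A†` are asymptotically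
left inverses of `A x`.

The embedding is `v ↦ (R ψ v, ψ v - A R ψ v)` off `o` and `v ↦ (b⁻¹ v, 0)` over `o`. It is
continuous at `o`: if `v` is near `b c`, then `ψ v ≈ A c`, so `R ψ v ≈ c` and the residual is small.
It is bounded below because `ψ v` is recovered as the residual plus `A` of the first component. By
`isBundleEmbedding_of_bounded_below` this suffices. -/

open Filter Bundle

/-! ### Neighborhoods in the total space and a criterion for embeddings -/

namespace IsContinuousBanachBundle

variable {𝕜 : Type*} [RCLike 𝕜] {X : Type*} [TopologicalSpace X] {F : Type*} {E : X → Type*}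
  [∀ x, NormedAddCommGroup (E x)] [∀ x, NormedSpace 𝕜 (E x)] [TopologicalSpace (TotalSpace F E)]

/-- Fiberwise addition is continuous, in terms of neighborhoods. -/
theorem exists_nhds_add_mem (hE : IsContinuousBanachBundle 𝕜 F E) {x : X} {e e' : E x}
    {W : Set (TotalSpace F E)} (hW : W ∈ 𝓝 (⟨x, e + e'⟩ : TotalSpace F E)) :
    ∃ W₁ ∈ 𝓝 (⟨x, e⟩ : TotalSpace F E), ∃ W₂ ∈ 𝓝 (⟨x, e'⟩ : TotalSpace F E),
      ∀ y (v w : E y), (⟨y, v⟩ : TotalSpace F E) ∈ W₁ → (⟨y, w⟩ : TotalSpace F E) ∈ W₂ →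
        (⟨y, v + w⟩ : TotalSpace F E) ∈ W := by
  have h := hE.continuous_add.continuousAt (x := ⟨x, (e, e')⟩) hW
  rw [(FiberBundle.Prod.isInducing_diag F E F E).nhds_eq_comap, mem_map, mem_comap] at h
  obtain ⟨S, hS, hSW⟩ := h
  obtain ⟨W₁, h₁, W₂, h₂, hS⟩ := mem_nhds_prod_iff.1 hS
  refine ⟨W₁, h₁, W₂, h₂, fun y v w hv hw ↦ ?_⟩
  exact @hSW ⟨y, (v, w)⟩ (hS ⟨hv, hw⟩)

theorem continuous_const_smul (hE : IsContinuousBanachBundle 𝕜 F E) (c : 𝕜) :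
    Continuous (fun v ↦ ⟨v.proj, c • v.snd⟩ : TotalSpace F E → TotalSpace F E) :=
  hE.continuous_smul.comp (Continuous.prodMk_right c)

/-- Vectors in a common fiber near a given vector are close to each other. -/
theorem exists_nhds_norm_sub_lt (hE : IsContinuousBanachBundle 𝕜 F E) {x : X} (e : E x)
    {ε : ℝ} (hε : 0 < ε) :
    ∃ W ∈ 𝓝 (⟨x, e⟩ : TotalSpace F E), ∀ y (v w : E y), (⟨y, v⟩ : TotalSpace F E) ∈ W →
      (⟨y, w⟩ : TotalSpace F E) ∈ W → ‖v - w‖ < ε := by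
  have h : {v : TotalSpace F E | ‖v.snd‖ < ε} ∈ 𝓝 (⟨x, e + (-1 : 𝕜) • e⟩ : TotalSpace F E) := by
    refine (isOpen_lt hE.continuous_norm continuous_const).mem_nhds ?_
    simpa using hε
  obtain ⟨W₁, h₁, W₂, h₂, h⟩ := hE.exists_nhds_add_mem h
  refine ⟨_, inter_mem h₁ ((hE.continuous_const_smul (-1)).continuousAt (x := ⟨x, e⟩) h₂),
    fun y v w hv hw ↦ ?_⟩
  simpa [sub_eq_add_neg] using h y v _ hv.1 hw.2

/-- A vector that is close to a vector near `e` in the same fiber is itself near `e`. -/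
theorem exists_nhds_mem_of_norm_sub_lt (hE : IsContinuousBanachBundle 𝕜 F E) {x : X} {e : E x}
    {W : Set (TotalSpace F E)} (hW : W ∈ 𝓝 (⟨x, e⟩ : TotalSpace F E)) :
    ∃ W' ∈ 𝓝 (⟨x, e⟩ : TotalSpace F E), ∃ ε > 0, ∀ y (v w : E y),
      (⟨y, w⟩ : TotalSpace F E) ∈ W' → ‖v - w‖ < ε → (⟨y, v⟩ : TotalSpace F E) ∈ W := by
  obtain ⟨W₁, h₁, W₂, h₂, h⟩ := hE.exists_nhds_add_mem (e := e) (e' := 0) (by simpa using hW)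
  obtain ⟨⟨U, ε⟩, ⟨hU, hxU, hε⟩, hUW⟩ := (hE.hasBasis_nhds_zero x).mem_iff.1 h₂
  refine ⟨_, inter_mem h₁ (hE.continuous_proj.continuousAt (x := ⟨x, e⟩) (hU.mem_nhds hxU)),
    ε, hε, fun y v w hw hvw ↦ ?_⟩
  have := h y w (v - w) hw.1 (hUW ⟨hw.2, hvw⟩)
  simpa using this

/-- Near the base point of a vector `e`, every fiber contains vectors near `e`. -/
theorem eventually_exists_of_eventually (hE : IsContinuousBanachBundle 𝕜 F E) {x : X} {e : E x}
    {p : TotalSpace F E → Prop} (hp : ∀ᶠ v in 𝓝 (⟨x, e⟩ : TotalSpace F E), p v) :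
    ∀ᶠ y in 𝓝 x, ∃ v : E y, p ⟨y, v⟩ := by
  filter_upwards [hE.isOpenMap_proj.image_mem_nhds hp]
  rintro _ ⟨⟨y, v⟩, hv, rfl⟩
  exact ⟨v, hv⟩

theorem eventually_proj (hE : IsContinuousBanachBundle 𝕜 F E) {x : X} (e : E x)
    {p : X → Prop} (hp : ∀ᶠ y in 𝓝 x, p y) :
    ∀ᶠ v : TotalSpace F E in 𝓝 ⟨x, e⟩, p v.proj :=
  hE.continuous_proj.continuousAt (x := ⟨x, e⟩) hp

/-- A continuous family of linear maps from the fibers to a fixed space that is locally uniformly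
bounded below is an embedding into a trivial bundle. -/
theorem isBundleEmbedding_of_bounded_below (hE : IsContinuousBanachBundle 𝕜 F E)
    {H : Type*} [NormedAddCommGroup H] [NormedSpace 𝕜 H] (Φ : ∀ x, E x →ₗ[𝕜] H)
    (hΦ : Continuous fun v : TotalSpace F E ↦ Φ v.proj v.snd)
    (hb : ∀ x, ∃ K > 0, ∀ᶠ y in 𝓝 x, ∀ v : E y, ‖v‖ ≤ K * ‖Φ y v‖) :
    IsBundleEmbedding 𝕜 F E H (Bundle.Trivial X H) Φ := by
  have hinj (x) : Function.Injective (Φ x) := by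
    obtain ⟨K, hK, h⟩ := hb x
    refine (injective_iff_map_eq_zero (Φ x)).2 fun v hv ↦ ?_
    have h0 := h.self_of_nhds v
    rw [hv, norm_zero, mul_zero] at h0
    exact norm_le_zero_iff.1 h0
  refine ⟨hinj, ?_⟩
  let f : TotalSpace F E → X × H := fun v ↦ (v.proj, Φ v.proj v.snd)
  have hf : IsEmbedding f := by
    refine ⟨isInducing_iff_nhds.2 fun ⟨x, e⟩ ↦ le_antisymm
      (hE.continuous_proj.prodMk hΦ).continuousAt.le_comap fun W hW ↦ ?_, ?_⟩
    · obtain ⟨K, hK, h⟩ := hb x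
      obtain ⟨W', hW', ε, hε, hWW⟩ := hE.exists_nhds_mem_of_norm_sub_lt hW
      have hδ : 0 < ε / (2 * K) := by positivity
      have hnear : ∀ᶠ v : TotalSpace F E in 𝓝 ⟨x, e⟩, v ∈ W' ∧
          dist (Φ v.proj v.snd) (Φ x e) < ε / (2 * K) :=
        (eventually_mem_set.2 hW').and (Metric.tendsto_nhds.1 (hΦ.continuousAt (x := ⟨x, e⟩)) _ hδ)
      -- Openness of the projection supplies a reference vector `w` near `e` in each nearby fiber.
      -- If `Φ y v` is near `Φ x e`, it is near `Φ y w`, and the lower bound makes `v` near `w`.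
      refine mem_comap.2 ⟨_, prod_mem_nhds (h.and (hE.eventually_exists_of_eventually hnear))
        (Metric.ball_mem_nhds (Φ x e) hδ), ?_⟩
      rintro ⟨y, v⟩ ⟨⟨hy, w, hw, hwe⟩, hv⟩
      refine hWW y v w hw ((hy _).trans_lt ?_)
      have hd : dist (Φ y v) (Φ y w) < ε / (2 * K) + ε / (2 * K) :=
        (dist_triangle_right _ _ (Φ x e)).trans_lt (add_lt_add hv hwe)
      rw [map_sub, ← dist_eq_norm]
      calc K * dist (Φ y v) (Φ y w) < K * (ε / (2 * K) + ε / (2 * K)) := by gcongr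
        _ = ε := by field_simp; ring
    · rintro ⟨x, v⟩ ⟨y, w⟩ h
      obtain rfl : x = y := congrArg Prod.fst h
      exact congrArg _ (hinj x (congrArg Prod.snd h))
  exact (Bundle.Trivial.homeomorphProd X H).symm.isEmbedding.comp hf

end IsContinuousBanachBundle

/-! ### Straightening a continuous family of norms -/

section UniformFrames

variable {𝕜 : Type*} [RCLike 𝕜] {Y : Type*} [TopologicalSpace Y]

/-- On the unit sphere `N y₀` is positive, so both inequalities are strict at `y₀`. They persist
nearby by compactness of the sphere and extend to all vectors by homogeneity. -/
theorem Seminorm.eventually_le_mul_of_continuous {V : Type*} [NormedAddCommGroup V]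
    [NormedSpace 𝕜 V] [FiniteDimensional 𝕜 V] {N : Y → Seminorm 𝕜 V}
    (hN : Continuous fun p : Y × V ↦ N p.1 p.2) (hN₀ : ∀ y v, N y v = 0 → v = 0)
    (y₀ : Y) {θ : ℝ} (hθ : 1 < θ) :
    ∀ᶠ y in 𝓝 y₀, ∀ v, N y v ≤ θ * N y₀ v ∧ N y₀ v ≤ θ * N y v := by
  have : ProperSpace V := FiniteDimensional.proper_rclike 𝕜 V
  have h : ∀ᶠ y in 𝓝 y₀, ∀ v ∈ Metric.sphere (0 : V) 1,
      N y v < θ * N y₀ v ∧ N y₀ v < θ * N y v := by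
    refine (isCompact_sphere (0 : V) 1).eventually_forall_of_forall_eventually fun v hv ↦ ?_
    have hv₀ : v ≠ 0 := ne_zero_of_mem_unit_sphere ⟨v, hv⟩
    have hpos : 0 < N y₀ v := (apply_nonneg _ _).lt_of_ne' fun h ↦ hv₀ (hN₀ _ _ h)
    have hN' : Continuous fun p : Y × V ↦ N y₀ p.2 :=
      hN.comp (.prodMk continuous_const continuous_snd)
    refine ((isOpen_lt hN (continuous_const.mul hN')).inter
      (isOpen_lt hN' (continuous_const.mul hN))).mem_nhds ⟨?_, ?_⟩ <;>
    · show N y₀ v < θ * N y₀ v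
      nlinarith
  filter_upwards [h] with y hy v
  rcases eq_or_ne v 0 with rfl | hv
  · simp
  have hv' : 0 < ‖v‖ := norm_pos_iff.2 hv
  obtain ⟨h₁, h₂⟩ := hy (((‖v‖ : 𝕜)⁻¹) • v) (by simp [norm_smul, hv'.ne'])
  simp only [map_smul_eq_mul, norm_inv, RCLike.norm_ofReal, abs_norm] at h₁ h₂
  have e₁ (a b : ℝ) (h : ‖v‖⁻¹ * a < θ * (‖v‖⁻¹ * b)) : a ≤ θ * b := by
    rw [mul_left_comm] at h
    exact le_of_mul_le_mul_left h.le (inv_pos.2 hv')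
  exact ⟨e₁ _ _ h₁, e₁ _ _ h₂⟩

theorem Seminorm.exists_pos_forall_norm_le {V : Type*} [NormedAddCommGroup V]
    [NormedSpace 𝕜 V] [FiniteDimensional 𝕜 V] (N : Seminorm 𝕜 V) (hN : Continuous N)
    (hN₀ : ∀ v, N v = 0 → v = 0) : ∃ κ > 0, ∀ v, ‖v‖ ≤ κ * N v := by
  have : ProperSpace V := FiniteDimensional.proper_rclike 𝕜 V
  rcases (Metric.sphere (0 : V) 1).eq_empty_or_nonempty with h | h
  · refine ⟨1, one_pos, fun v ↦ ?_⟩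
    rcases eq_or_ne v 0 with rfl | hv
    · simp
    · have : ((‖v‖ : 𝕜)⁻¹) • v ∈ Metric.sphere (0 : V) 1 := by simp [norm_smul, hv]
      simp [h] at this
  obtain ⟨w, hw, hmin⟩ := (isCompact_sphere (0 : V) 1).exists_isMinOn h hN.continuousOn
  have hpos : 0 < N w :=
    (apply_nonneg _ _).lt_of_ne' fun h ↦ ne_zero_of_mem_unit_sphere ⟨w, hw⟩ (hN₀ _ h)
  refine ⟨(N w)⁻¹, inv_pos.2 hpos, fun v ↦ ?_⟩
  rcases eq_or_ne v 0 with rfl | hv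
  · simp
  have hv' : 0 < ‖v‖ := norm_pos_iff.2 hv
  have h₁ : N w ≤ N (((‖v‖ : 𝕜)⁻¹) • v) := hmin (by simp [norm_smul, hv'.ne'])
  simp only [map_smul_eq_mul, norm_inv, RCLike.norm_ofReal, abs_norm] at h₁
  rw [inv_mul_eq_div, le_div_iff₀ hv'] at h₁
  rw [inv_mul_eq_div, le_div_iff₀ hpos]
  linarith

/-- Near-best approximations of a vector in a subspace can be chosen continuously in the norm. -/
theorem Seminorm.exists_continuous_near_best_approx [NormalSpace Y] [ParacompactSpace Y]
    {V : Type*} [NormedAddCommGroup V] [NormedSpace 𝕜 V] [NormedSpace ℝ V] [IsScalarTower ℝ 𝕜 V]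
    [FiniteDimensional 𝕜 V] {N : Y → Seminorm 𝕜 V}
    (hN : Continuous fun p : Y × V ↦ N p.1 p.2) (hN₀ : ∀ y v, N y v = 0 → v = 0)
    (S : Submodule 𝕜 V) {e : V} (he : e ∉ S) :
    ∃ c : C(Y, V), ∀ y, c y ∈ S ∧ ∀ d ∈ S, N y (e - c y) ≤ 2 * N y (e - d) := by
  -- Exact nearest points need not be unique or continuous. The points optimal up to a factor 2 form
  -- a convex set, and a constant choice stays in it locally, so a partition of unity applies.
  refine exists_continuous_forall_mem_convex_of_local_const
    (t := fun y ↦ {c : V | c ∈ S ∧ ∀ d ∈ S, N y (e - c) ≤ 2 * N y (e - d)})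
    (fun y ↦ ?_) (fun y₀ ↦ ?_)
  · rintro c ⟨hc, hc'⟩ c' ⟨hd, hd'⟩ a b ha hb hab
    refine ⟨S.add_mem (S.smul_of_tower_mem a hc) (S.smul_of_tower_mem b hd), fun d hdS ↦ ?_⟩
    have hsmul (r : ℝ) (hr : 0 ≤ r) (v : V) : N y (r • v) = r * N y v := by
      rw [← algebraMap_smul 𝕜 r v, map_smul_eq_mul]
      simp [abs_of_nonneg hr]
    have heq : e - (a • c + b • c') = a • (e - c) + b • (e - c') := by
      rw [smul_sub, smul_sub, sub_add_sub_comm, ← add_smul, hab, one_smul]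
    rw [heq]
    calc _ ≤ a * N y (e - c) + b * N y (e - c') :=
          (map_add_le_add _ _ _).trans_eq (by rw [hsmul a ha, hsmul b hb])
      _ ≤ a * (2 * N y (e - d)) + b * (2 * N y (e - d)) := by
          gcongr
          exacts [hc' d hdS, hd' d hdS]
      _ = 2 * N y (e - d) := by rw [← add_mul, hab, one_mul]
  · obtain ⟨κ, hκ, hle⟩ := (N y₀).exists_pos_forall_norm_le (hN.comp (Continuous.prodMk_right y₀))
      (hN₀ y₀)
    have hclosed : IsClosed (S : Set V) := S.closed_of_finiteDimensional
    have hdist : 0 < Metric.infDist e S :=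
      (hclosed.notMem_iff_infDist_pos S.nonempty).1 he
    let A : Set ℝ := (fun d ↦ N y₀ (e - d)) '' S
    have hA : A.Nonempty := S.nonempty.image _
    have hlow : ∀ a ∈ A, Metric.infDist e S / κ ≤ a := by
      rintro _ ⟨d, hd, rfl⟩
      rw [div_le_iff₀' hκ]
      exact (Metric.infDist_le_dist_of_mem hd).trans ((dist_eq_norm e d).trans_le (hle _))
    have hpos : 0 < sInf A := (div_pos hdist hκ).trans_le (le_csInf hA hlow)
    obtain ⟨_, ⟨c, hc, rfl⟩, hlt⟩ : ∃ a ∈ A, a < 3 / 2 * sInf A :=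
      exists_lt_of_csInf_lt hA (by linarith)
    refine ⟨c, ?_⟩
    -- The factors combine to `(11/10)² * (3/2) = 1.815 < 2`.
    filter_upwards [eventually_le_mul_of_continuous hN hN₀ y₀ (θ := 11 / 10) (by norm_num)]
      with y hy
    refine ⟨hc, fun d hd ↦ ?_⟩
    have h₁ : sInf A ≤ N y₀ (e - d) := csInf_le ⟨_, hlow⟩ ⟨d, hd, rfl⟩
    have h₂ := (hy (e - c)).1
    have h₃ := (hy (e - d)).2
    have h₄ : 0 ≤ N y (e - d) := apply_nonneg _ _
    simp only at hlt
    linarith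

/-- The last vector has distance at least `1/2` from a subspace containing the earlier ones, so the
last coefficient is at most `2 * N v`. Removing that term leaves a vector of seminorm at most `3 * N
v`, so each step of the induction costs a factor 3. -/
theorem Seminorm.norm_coeff_le_of_flag {V : Type*} [AddCommGroup V] [Module 𝕜 V]
    (N : Seminorm 𝕜 V) (S : ℕ → Submodule 𝕜 V) {n : ℕ} (f : Fin n → V)
    (hfS : ∀ i j : Fin n, i < j → f i ∈ S j) (hf₁ : ∀ i, N (f i) ≤ 1)
    (hf : ∀ i : Fin n, ∀ d ∈ S i, 1 ≤ 2 * N (f i - d)) (a : Fin n → 𝕜) (i : Fin n) :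
    ‖a i‖ ≤ 3 ^ n * N (∑ j, a j • f j) := by
  induction n with
  | zero => exact i.elim0
  | succ n ih =>
    set v := ∑ j, a j • f j with hv
    set w := ∑ j : Fin n, a j.castSucc • f j.castSucc with hw
    have hvw : v = w + a (Fin.last n) • f (Fin.last n) := Fin.sum_univ_castSucc _
    have hlast : ‖a (Fin.last n)‖ ≤ 2 * N v := by
      rcases eq_or_ne (a (Fin.last n)) 0 with h | h
      · simp [h]
      have hwS : -((a (Fin.last n))⁻¹ • w) ∈ S (Fin.last n) :=
        neg_mem (Submodule.smul_mem _ _ (Submodule.sum_mem _ fun j _ ↦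
          Submodule.smul_mem _ _ (hfS _ _ (Fin.castSucc_lt_last j))))
      have h₁ := hf _ _ hwS
      have h₂ : f (Fin.last n) - -((a (Fin.last n))⁻¹ • w) = (a (Fin.last n))⁻¹ • v := by
        rw [hvw, smul_add, smul_smul, inv_mul_cancel₀ h, one_smul]; abel
      rw [h₂, map_smul_eq_mul, norm_inv, mul_left_comm, inv_mul_eq_div,
        le_div_iff₀ (norm_pos_iff.2 h), one_mul] at h₁
      exact h₁
    have hNv : 0 ≤ N v := apply_nonneg _ _
    refine Fin.lastCases ?_ (fun i ↦ ?_) i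
    · have : (1 : ℝ) ≤ 3 ^ n := one_le_pow₀ (by norm_num)
      rw [pow_succ]
      nlinarith
    · have h₁ : ‖a i.castSucc‖ ≤ 3 ^ n * N w := ih (fun i ↦ f i.castSucc)
        (fun i j hij ↦ hfS _ _ (Fin.castSucc_lt_castSucc_iff.2 hij)) (fun i ↦ hf₁ _)
        (fun i d hd ↦ hf i.castSucc d hd) (fun i ↦ a i.castSucc) i
      have h₂ : N w ≤ 3 * N v := by
        have h : w = v - a (Fin.last n) • f (Fin.last n) := by rw [hvw]; abel
        have h' : ‖a (Fin.last n)‖ * N (f (Fin.last n)) ≤ 2 * N v * 1 := by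
          gcongr
          exact hf₁ _
        rw [h]
        refine (map_sub_le_add _ _ _).trans ?_
        rw [map_smul_eq_mul]
        linarith
      rw [pow_succ, mul_assoc]
      exact h₁.trans (by gcongr)

/-- A continuous family of norms on `𝕜ⁿ` becomes uniformly equivalent to the standard norm after a
continuous family of changes of coordinates. -/
theorem Seminorm.exists_continuous_uniform_coordinates [NormalSpace Y] [ParacompactSpace Y] {n : ℕ}
    {N : Y → Seminorm 𝕜 (EuclideanSpace 𝕜 (Fin n))}
    (hN : Continuous fun p : Y × EuclideanSpace 𝕜 (Fin n) ↦ N p.1 p.2)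
    (hN₀ : ∀ y v, N y v = 0 → v = 0) :
    ∃ C > 0, ∃ G : Y → EuclideanSpace 𝕜 (Fin n) →L[𝕜] EuclideanSpace 𝕜 (Fin n), Continuous G ∧
      ∀ y v, ‖G y v‖ ≤ C * N y v ∧ N y v ≤ C * ‖G y v‖ := by
  -- The standard flag: `S i` is spanned by the first `i` basis vectors. Subtracting from `e i` a
  -- near-best approximation in `S i` and normalizing gives a frame `f y` that is almost orthonormal
  -- for `N y`.
  let S (i : ℕ) : Submodule 𝕜 (EuclideanSpace 𝕜 (Fin n)) :=
    { carrier := {v | ∀ j : Fin n, i ≤ j → v j = 0}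
      add_mem' := fun hv hw j hj ↦ by simp [hv j hj, hw j hj]
      zero_mem' := fun j _ ↦ rfl
      smul_mem' := fun c v hv j hj ↦ by simp [hv j hj] }
  let e (i : Fin n) : EuclideanSpace 𝕜 (Fin n) := EuclideanSpace.single i 1
  have he (i : Fin n) : e i ∉ S i := fun h ↦ by simpa [e] using h i le_rfl
  choose c hcS hc using fun i : Fin n ↦ exists_continuous_near_best_approx hN hN₀ (S i) (he i)
  let g (y : Y) (i : Fin n) : EuclideanSpace 𝕜 (Fin n) := e i - c i y
  have hg₀ (y i) : 0 < N y (g y i) := by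
    refine (apply_nonneg _ _).lt_of_ne' fun h ↦ he i ?_
    rw [sub_eq_zero.1 (hN₀ y _ h)]
    exact hcS i y
  have hgc (i) : Continuous fun y ↦ g y i := continuous_const.sub (c i).continuous
  have hgN (i) : Continuous fun y ↦ N y (g y i) := hN.comp (continuous_id.prodMk (hgc i))
  let r (y : Y) (i : Fin n) : 𝕜 := ((N y (g y i) : ℝ) : 𝕜)⁻¹
  have hr (y i) (v) : N y (r y i • v) = (N y (g y i))⁻¹ * N y v := by
    rw [map_smul_eq_mul, norm_inv, RCLike.norm_ofReal, abs_of_pos (hg₀ y i)]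
  have hr₀ (y i) : r y i ≠ 0 := inv_ne_zero (RCLike.ofReal_ne_zero.2 (hg₀ y i).ne')
  have hrc (i) : Continuous fun y ↦ r y i :=
    (RCLike.continuous_ofReal.comp (hgN i)).inv₀ fun y ↦ RCLike.ofReal_ne_zero.2 (hg₀ y i).ne'
  let f (y : Y) (i : Fin n) := r y i • g y i
  have hf₁ (y i) : N y (f y i) = 1 := by rw [hr, inv_mul_cancel₀ (hg₀ y i).ne']
  have hfS (y) (i j : Fin n) (hij : i < j) : f y i ∈ S j := by
    refine Submodule.smul_mem _ _ (Submodule.sub_mem _ (fun l hl ↦ ?_) fun l hl ↦ ?_)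
    · have hne : l ≠ i := (hij.trans_le hl).ne'
      simp [e, hne]
    · exact hcS i y l (le_trans (Fin.le_def.1 hij.le) hl)
  have hf (y) (i : Fin n) (d) (hd : d ∈ S i) : 1 ≤ 2 * N y (f y i - d) := by
    have h : f y i - d = r y i • (e i - (c i y + (r y i)⁻¹ • d)) := by
      rw [← sub_sub, smul_sub _ (e i - c i y), smul_inv_smul₀ (hr₀ y i)]
    have h₁ := hc i y _ (add_mem (hcS i y) (Submodule.smul_mem _ (r y i)⁻¹ hd))
    rw [h, hr, mul_left_comm, inv_mul_eq_div, le_div_iff₀ (hg₀ y i), one_mul]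
    exact h₁
  let M (y : Y) : EuclideanSpace 𝕜 (Fin n) →L[𝕜] EuclideanSpace 𝕜 (Fin n) :=
    ∑ i, (EuclideanSpace.proj i : EuclideanSpace 𝕜 (Fin n) →L[𝕜] 𝕜).smulRight (f y i)
  have hM (y v) : M y v = ∑ i, v i • f y i := by simp [M]
  have hMc : Continuous M := by
    refine _root_.continuous_finsetSum _ fun i _ ↦ ?_
    exact (ContinuousLinearMap.smulRightL 𝕜 _ _ (EuclideanSpace.proj i)).continuous.comp
      ((hrc i).smul (hgc i))
  -- The summand 1 keeps `C` positive for `n = 0`.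
  let C : ℝ := (n + 1) * 3 ^ n
  have hC₁ : (n : ℝ) + 1 ≤ C := le_mul_of_one_le_right (by positivity) (one_le_pow₀ (by norm_num))
  have hlow (y v) : ‖v‖ ≤ C * N y (M y v) := by
    have h₁ (i) := norm_coeff_le_of_flag (N y) (fun i ↦ S i) (f y) (hfS y) (fun i ↦ (hf₁ y i).le)
      (hf y) v i
    rw [← hM] at h₁
    have h₂ : v = ∑ i, EuclideanSpace.single i (v i) := by
      ext j; simp [Finset.sum_apply, Pi.single_apply]
    calc ‖v‖ ≤ ∑ i, ‖v i‖ := by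
          conv_lhs => rw [h₂]
          exact (norm_sum_le _ _).trans_eq (by simp)
      _ ≤ ∑ i : Fin n, 3 ^ n * N y (M y v) := Finset.sum_le_sum fun i _ ↦ h₁ i
      _ = n * (3 ^ n * N y (M y v)) := by simp
      _ ≤ C * N y (M y v) := by
          rw [← mul_assoc]
          refine mul_le_mul_of_nonneg_right ?_ (apply_nonneg _ _)
          exact mul_le_mul_of_nonneg_right (by linarith) (by positivity)
  have hup (y v) : N y (M y v) ≤ C * ‖v‖ := by
    rw [hM]
    calc _ ≤ ∑ i, N y (v i • f y i) :=
          Finset.le_sum_of_subadditive _ (map_zero (N y)).le (map_add_le_add _) _ _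
      _ ≤ ∑ i : Fin n, ‖v‖ := Finset.sum_le_sum fun i _ ↦ by
          rw [map_smul_eq_mul, hf₁, mul_one]
          exact PiLp.norm_apply_le v i
      _ = n * ‖v‖ := by simp
      _ ≤ C * ‖v‖ := by gcongr; linarith
  have hinj (y) : Function.Injective (M y) := by
    refine (injective_iff_map_eq_zero (M y)).2 fun v hv ↦ ?_
    have := hlow y v
    rw [hv, map_zero, mul_zero] at this
    exact norm_le_zero_iff.1 this
  have hunit (y) : IsUnit (M y) := by
    refine ⟨ContinuousLinearEquiv.unitsEquiv 𝕜 _ |>.symm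
      (LinearEquiv.ofInjectiveEndo (M y : _ →ₗ[𝕜] _) (hinj y)).toContinuousLinearEquiv, ?_⟩
    ext v
    rfl
  refine ⟨C, by positivity, fun y ↦ Ring.inverse (M y), ?_, fun y v ↦ ?_⟩
  · refine continuous_iff_continuousAt.2 fun y ↦ ?_
    obtain ⟨u, hu⟩ := hunit y
    exact ContinuousAt.comp (f := M) (hu ▸ NormedRing.inverse_continuousAt u) hMc.continuousAt
  · have h : M y (Ring.inverse (M y) v) = v :=
      DFunLike.congr_fun (Ring.mul_inverse_cancel _ (hunit y)) v
    have h₁ := hlow y (Ring.inverse (M y) v)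
    have h₂ := hup y (Ring.inverse (M y) v)
    rw [h] at h₁ h₂
    exact ⟨h₁, h₂⟩

end UniformFrames

/-! ### Coordinates uniformly comparable to the fiber norms -/

section UniformCoordinates

variable {𝕜 : Type*} [RCLike 𝕜] {X : Type*} [PseudoMetricSpace X] {F : Type*} {E : X → Type*}
  [∀ x, NormedAddCommGroup (E x)] [∀ x, NormedSpace 𝕜 (E x)] [TopologicalSpace (TotalSpace F E)]

/-- The trivialization transports the fiber norms to a continuous family of norms on `𝕜ⁿ` over `U`.
Straightening this family makes the coordinates uniform up to the edge of `U`. -/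
theorem IsContinuousBanachBundle.exists_uniform_coordinates_of_isTrivializableOver
    (hE : IsContinuousBanachBundle 𝕜 F E) {U : Set X} (hU : IsTrivializableOver 𝕜 F E U) :
    ∃ n, ∃ C > 0, ∃ g : ∀ x, E x →ₗ[𝕜] EuclideanSpace 𝕜 (Fin n),
      (∀ x ∈ U, ∀ v, ‖g x v‖ ≤ C * ‖v‖ ∧ ‖v‖ ≤ C * ‖g x v‖) ∧
      ∀ v : TotalSpace F E, v.proj ∈ U →
        ContinuousAt (fun v : TotalSpace F E ↦ g v.proj v.snd) v := by
  classical
  obtain ⟨n, e, rfl, hlin⟩ := hU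
  have hinj (x : e.baseSet) : Function.Injective fun v : E x ↦ (e ⟨x, v⟩).2 := fun v w h ↦ by
    have hs (v : E x) : (⟨x, v⟩ : TotalSpace F E) ∈ e.source := e.mem_source.2 x.2
    have := e.injOn (hs v) (hs w) (Prod.ext ((e.coe_fst (hs v)).trans (e.coe_fst (hs w)).symm) h)
    simpa using this
  have hsurj (x : e.baseSet) (c) : ∃ v : E x, e.toOpenPartialHomeomorph.symm (x, c) = ⟨x, v⟩ := by
    have h := e.proj_symm_apply' (x := c) x.2
    generalize e.toOpenPartialHomeomorph.symm (x, c) = p at h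
    obtain ⟨y, v⟩ := p
    obtain rfl : y = x := h
    exact ⟨v, rfl⟩
  choose s hs using hsurj
  have hes (x : e.baseSet) (c) : (e ⟨x, s x c⟩).2 = c := by
    rw [← hs, e.apply_symm_apply' x.2]
  let ℓ (x : e.baseSet) : E x ≃ₗ[𝕜] EuclideanSpace 𝕜 (Fin n) :=
    LinearEquiv.ofBijective (IsLinearMap.mk' _ (hlin x x.2)) ⟨hinj x, fun c ↦ ⟨s x c, hes x c⟩⟩
  have hℓs (x c) : (ℓ x).symm c = s x c := (ℓ x).symm_apply_eq.2 (hes x c).symm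
  let N (x : e.baseSet) : Seminorm 𝕜 (EuclideanSpace 𝕜 (Fin n)) :=
    (normSeminorm 𝕜 (E x)).comp (ℓ x).symm.toLinearMap
  have hN (x c) : N x c = ‖s x c‖ := congrArg norm (hℓs x c)
  have hNc : Continuous fun p : e.baseSet × EuclideanSpace 𝕜 (Fin n) ↦ N p.1 p.2 := by
    have h : Continuous fun p : e.baseSet × EuclideanSpace 𝕜 (Fin n) ↦
        e.toOpenPartialHomeomorph.symm ((p.1 : X), p.2) :=
      e.toOpenPartialHomeomorph.continuousOn_symm.comp_continuous
        (f := fun p : e.baseSet × EuclideanSpace 𝕜 (Fin n) ↦ ((p.1 : X), p.2))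
        (by fun_prop) fun p ↦ e.mem_target.2 p.1.2
    refine (hE.continuous_norm.comp h).congr fun p ↦ ?_
    rw [hN, Function.comp_apply, hs]
  obtain ⟨C, hC, G, hGc, hG⟩ := Seminorm.exists_continuous_uniform_coordinates hNc fun x c h ↦ by
    have h' : ‖(ℓ x).symm c‖ = 0 := h
    simpa using h'
  refine ⟨n, C, hC, fun x ↦ if h : x ∈ e.baseSet then
    (G ⟨x, h⟩ : _ →ₗ[𝕜] _) ∘ₗ (ℓ ⟨x, h⟩).toLinearMap else 0, fun x hx v ↦ ?_, fun v hv ↦ ?_⟩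
  · have h : N ⟨x, hx⟩ (ℓ ⟨x, hx⟩ v) = ‖v‖ := congrArg norm ((ℓ ⟨x, hx⟩).symm_apply_apply v)
    simpa [hx, h] using hG ⟨x, hx⟩ (ℓ ⟨x, hx⟩ v)
  · have ho : IsOpen {v : TotalSpace F E | v.proj ∈ e.baseSet} :=
      e.open_baseSet.preimage hE.continuous_proj
    refine ContinuousOn.continuousAt (continuousOn_iff_continuous_domRestrict.2 ?_) (ho.mem_nhds hv)
    have h₁ : Continuous fun w : {v : TotalSpace F E | v.proj ∈ e.baseSet} ↦ (e w.1).2 :=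
      continuous_snd.comp (e.toOpenPartialHomeomorph.continuousOn.comp_continuous
        continuous_subtype_val fun w ↦ e.mem_source.2 w.2)
    have h₂ : Continuous fun w : {v : TotalSpace F E | v.proj ∈ e.baseSet} ↦
        G ⟨w.1.proj, w.2⟩ :=
      hGc.comp ((hE.continuous_proj.comp continuous_subtype_val).subtype_mk _)
    refine (h₂.clm_apply h₁).congr fun w ↦ ?_
    have hw : w.1.proj ∈ e.baseSet := w.2
    simp only [Set.domRestrict_apply, hw, dite_true]
    rfl

/-- The maps `ρ j • g j`, with `ρ` a partition of unity on `S`, are the components of `ψ`. The lower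
bound holds because the weights sum to 1. -/
theorem IsContinuousBanachBundle.exists_uniform_coordinates_of_isFiniteTypeOver
    (hE : IsContinuousBanachBundle 𝕜 F E) {S : Set X} (hS : IsFiniteTypeOver 𝕜 F E S)
    (hne : S ≠ Set.univ) :
    ∃ n, ∃ C > 0, ∃ ψ : ∀ x, E x →ₗ[𝕜] EuclideanSpace 𝕜 (Fin n),
      (∀ x ∈ S, ∀ v, ‖ψ x v‖ ≤ C * ‖v‖ ∧ ‖v‖ ≤ C * ‖ψ x v‖) ∧
      ∀ v : TotalSpace F E, v.proj ∈ S →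
        ContinuousAt (fun v : TotalSpace F E ↦ ψ v.proj v.snd) v := by
  obtain ⟨k, U, rfl, hU⟩ := hS
  choose n C hC g hg hgc using
    fun j ↦ hE.exists_uniform_coordinates_of_isTrivializableOver (hU j).2
  -- `Metric.infDist` to the empty set is 0, so the weights `δ j` detect `U j` only if its
  -- complement is nonempty; this is where `S ≠ Set.univ` enters.
  have hUne (j) : ((U j)ᶜ).Nonempty := by
    rw [Set.nonempty_compl]
    exact fun h ↦ hne (Set.eq_univ_of_subset (Set.subset_iUnion U j) h)
  let δ (j) (x : X) : ℝ := Metric.infDist x (U j)ᶜ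
  have hδ₀ (j x) : 0 ≤ δ j x := Metric.infDist_nonneg
  have hδc (j) : Continuous (δ j) := Metric.continuous_infDist_pt _
  have hδU {j x} (hx : x ∉ U j) : δ j x = 0 := Metric.infDist_zero_of_mem hx
  have hsum {x} (hx : x ∈ ⋃ j, U j) : 0 < ∑ j, δ j x := by
    obtain ⟨j, hj⟩ := Set.mem_iUnion.1 hx
    refine Finset.sum_pos' (fun i _ ↦ hδ₀ i x) ⟨j, Finset.mem_univ j, ?_⟩
    exact ((hU j).1.isClosed_compl.notMem_iff_infDist_pos (hUne j)).1 (not_not_intro hj)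
  let ρ (j) (x : X) : ℝ := δ j x / ∑ i, δ i x
  have hρ₀ (j x) : 0 ≤ ρ j x := div_nonneg (hδ₀ j x) (Finset.sum_nonneg fun i _ ↦ hδ₀ i x)
  have hρU {j x} (hx : x ∉ U j) : ρ j x = 0 := by simp [ρ, hδU hx]
  have hρ₁ {x} (hx : x ∈ ⋃ j, U j) : ∑ j, ρ j x = 1 := by
    rw [← Finset.sum_div, div_self (hsum hx).ne']
  have hρle (j x) : ρ j x ≤ 1 :=
    div_le_one_of_le₀ (Finset.single_le_sum (fun i _ ↦ hδ₀ i x) (Finset.mem_univ j))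
      (Finset.sum_nonneg fun i _ ↦ hδ₀ i x)
  have hρc (j) {x} (hx : x ∈ ⋃ j, U j) : ContinuousAt (ρ j) x :=
    (hδc j).continuousAt.div (_root_.continuous_finsetSum _ fun i _ ↦ hδc i).continuousAt
      (hsum hx).ne'
  have hρg (j x) (v : E x) : ‖(ρ j x : 𝕜) • g j x v‖ ≤ ρ j x * (C j * ‖v‖) := by
    by_cases hx : x ∈ U j
    · rw [norm_smul, RCLike.norm_ofReal, abs_of_nonneg (hρ₀ j x)]
      exact mul_le_mul_of_nonneg_left (hg j x hx v).1 (hρ₀ j x)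
    · simp [hρU hx]
  let H := ∀ j, EuclideanSpace 𝕜 (Fin (n j))
  let V := EuclideanSpace 𝕜 (Fin (Module.finrank 𝕜 H))
  let T : H ≃L[𝕜] V :=
    ContinuousLinearEquiv.ofFinrankEq finrank_euclideanSpace_fin.symm
  let θ (x : X) : E x →ₗ[𝕜] H := LinearMap.pi fun j ↦ (ρ j x : 𝕜) • g j x
  have hθ (x) (v : E x) (j) : θ x v j = (ρ j x : 𝕜) • g j x v := rfl
  let B : ℝ := ∑ j, C j
  have hB₀ : 0 ≤ B := Finset.sum_nonneg fun j _ ↦ (hC j).le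
  have hθ₁ (x) (v : E x) : ‖θ x v‖ ≤ B * ‖v‖ := by
    refine (pi_norm_le_iff_of_nonneg (by positivity)).2 fun j ↦ ?_
    have h₁ : C j ≤ B := Finset.single_le_sum (fun i _ ↦ (hC i).le) (Finset.mem_univ j)
    refine (hρg j x v).trans ?_
    calc _ ≤ 1 * (C j * ‖v‖) :=
          mul_le_mul_of_nonneg_right (hρle j x) (mul_nonneg (hC j).le (norm_nonneg v))
      _ ≤ B * ‖v‖ := by rw [one_mul]; gcongr
  have hθ₂ {x} (hx : x ∈ ⋃ j, U j) (v : E x) : ‖v‖ ≤ B * ‖θ x v‖ := by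
    calc ‖v‖ = ∑ j, ρ j x * ‖v‖ := by rw [← Finset.sum_mul, hρ₁ hx, one_mul]
      _ ≤ ∑ j, C j * ‖θ x v‖ := Finset.sum_le_sum fun j _ ↦ ?_
      _ = B * ‖θ x v‖ := (Finset.sum_mul _ _ _).symm
    by_cases hxj : x ∈ U j
    · calc ρ j x * ‖v‖ ≤ ρ j x * (C j * ‖g j x v‖) :=
            mul_le_mul_of_nonneg_left (hg j x hxj v).2 (hρ₀ j x)
        _ = C j * ‖θ x v j‖ := by
            rw [hθ, norm_smul, RCLike.norm_ofReal, abs_of_nonneg (hρ₀ j x)]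
            ring
        _ ≤ C j * ‖θ x v‖ := mul_le_mul_of_nonneg_left (norm_le_pi_norm _ j) (hC j).le
    · rw [hρU hxj, zero_mul]
      exact mul_nonneg (hC j).le (norm_nonneg _)
  have hθc (v : TotalSpace F E) (hv : v.proj ∈ ⋃ j, U j) :
      ContinuousAt (fun v : TotalSpace F E ↦ θ v.proj v.snd) v := by
    refine continuousAt_pi.2 fun j ↦ ?_
    have hρv : ContinuousAt (fun v : TotalSpace F E ↦ ρ j v.proj) v :=
      ContinuousAt.comp (hρc j hv) hE.continuous_proj.continuousAt
    by_cases hj : v.proj ∈ U j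
    · exact ((RCLike.continuous_ofReal (K := 𝕜)).continuousAt.comp
        (f := fun v : TotalSpace F E ↦ ρ j v.proj) hρv).smul (hgc j v hj)
    -- At points of `S` outside `U j` nothing is known about continuity of `g j`. Its uniform bound
    -- on `U j` lets the vanishing weight force the product to 0.
    · have h₀ : θ v.proj v.snd j = 0 := by simp [hθ, hρU hj]
      have h₁ : Tendsto (fun w : TotalSpace F E ↦ ρ j w.proj * (C j * ‖w.snd‖)) (𝓝 v) (𝓝 0) := by
        have := hρv.tendsto.mul
          ((continuous_const (y := C j)).mul hE.continuous_norm).continuousAt.tendsto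
        rwa [hρU hj, zero_mul] at this
      rw [ContinuousAt, h₀]
      exact squeeze_zero_norm (fun w ↦ hρg j w.proj w.snd) h₁
  let D : ℝ := ‖(T : H →L[𝕜] V)‖ + ‖(T.symm : V →L[𝕜] H)‖ + 1
  have hD₀ : 0 < D := by positivity
  refine ⟨_, D * (B + 1), by positivity, fun x ↦ T.toLinearEquiv.toLinearMap ∘ₗ θ x,
    fun x hx v ↦ ⟨?_, ?_⟩, fun v hv ↦ T.continuous.continuousAt.comp (hθc v hv)⟩
  · calc ‖T (θ x v)‖ ≤ ‖(T : H →L[𝕜] V)‖ * ‖θ x v‖ := (T : H →L[𝕜] V).le_opNorm _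
      _ ≤ D * ((B + 1) * ‖v‖) := by
          have h₁ : ‖(T : H →L[𝕜] V)‖ ≤ D := by
            linarith [norm_nonneg (T.symm : V →L[𝕜] H)]
          have h₂ : ‖θ x v‖ ≤ (B + 1) * ‖v‖ := by linarith [hθ₁ x v, norm_nonneg v]
          gcongr
      _ = _ := (mul_assoc _ _ _).symm
  · have h₁ : ‖θ x v‖ ≤ D * ‖T (θ x v)‖ := by
      have h := (T.symm : V →L[𝕜] H).le_opNorm (T (θ x v))
      rw [ContinuousLinearEquiv.coe_coe, T.symm_apply_apply] at h
      refine h.trans ?_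
      gcongr
      linarith [norm_nonneg (T : H →L[𝕜] V)]
    calc ‖v‖ ≤ B * ‖θ x v‖ := hθ₂ hx v
      _ ≤ (B + 1) * (D * ‖T (θ x v)‖) := by gcongr; linarith
      _ = D * (B + 1) * ‖T (θ x v)‖ := by ring

end UniformCoordinates

/-! ### Tikhonov regularization -/

section RegularizedInverse

open ContinuousLinearMap

variable {𝕜 : Type*} [RCLike 𝕜] {V W : Type*} [NormedAddCommGroup V] [InnerProductSpace 𝕜 V]
  [CompleteSpace V] [NormedAddCommGroup W]
  [InnerProductSpace 𝕜 W] [CompleteSpace W]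

/-- Pair `(A†A + t) c` with `c` and apply Cauchy–Schwarz. -/
theorem norm_mul_le_norm_adjoint_comp_add_smul (A : V →L[𝕜] W) {t δ : ℝ}
    (c : V) (h : δ * ‖c‖ ^ 2 ≤ ‖A c‖ ^ 2 + t * ‖c‖ ^ 2) :
    δ * ‖c‖ ≤ ‖(adjoint A ∘L A + (t : 𝕜) • 1) c‖ := by
  rcases eq_or_ne c 0 with rfl | hc
  · simp
  have h₁ : RCLike.re (inner 𝕜 ((adjoint A ∘L A + (t : 𝕜) • 1) c) c) = ‖A c‖ ^ 2 + t * ‖c‖ ^ 2 := by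
    simp [inner_add_left, adjoint_inner_left, inner_smul_left, inner_self_eq_norm_sq_to_K]
  have h₂ := h.trans (h₁.symm.le.trans (re_inner_le_norm (𝕜 := 𝕜) _ c))
  rw [sq, ← mul_assoc] at h₂
  exact le_of_mul_le_mul_right h₂ (norm_pos_iff.2 hc)

/-- The Tikhonov regularization `(A† A + t)⁻¹ A†` of a left inverse of `A`. -/
noncomputable def ContinuousLinearMap.regularizedInverse (A : V →L[𝕜] W) (t : ℝ) :
    W →L[𝕜] V :=
  Ring.inverse (adjoint A ∘L A + (t : 𝕜) • 1) ∘L adjoint A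

variable [FiniteDimensional 𝕜 V]

theorem isUnit_adjoint_comp_add_smul (A : V →L[𝕜] W) {t : ℝ} (ht : 0 < t) :
    IsUnit (adjoint A ∘L A + (t : 𝕜) • 1) := by
  have hinj : Function.Injective (adjoint A ∘L A + (t : 𝕜) • 1 : V →L[𝕜] V) := by
    refine (injective_iff_map_eq_zero _).2 fun c hc ↦ ?_
    have h := norm_mul_le_norm_adjoint_comp_add_smul A (t := t) (δ := t) c
      (le_add_of_nonneg_left (by positivity))
    rw [hc, norm_zero] at h
    exact norm_le_zero_iff.1 (nonpos_of_mul_nonpos_right h ht)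
  refine ⟨(ContinuousLinearEquiv.unitsEquiv 𝕜 V).symm
    (LinearEquiv.ofInjectiveEndo ((adjoint A ∘L A + (t : 𝕜) • 1 : V →L[𝕜] V) : V →ₗ[𝕜] V)
      hinj).toContinuousLinearEquiv, ?_⟩
  ext v
  rfl

theorem adjoint_comp_add_smul_regularizedInverse (A : V →L[𝕜] W) {t : ℝ} (ht : 0 < t) (h : W) :
    (adjoint A ∘L A + (t : 𝕜) • 1) (A.regularizedInverse t h) = adjoint A h :=
  DFunLike.congr_fun (Ring.mul_inverse_cancel _ (isUnit_adjoint_comp_add_smul A ht)) (adjoint A h)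

/-- The point is that the bound does not involve `t`, so it survives `t → 0`. -/
theorem norm_regularizedInverse_le (A : V →L[𝕜] W) {t δ : ℝ} (ht : 0 < t) (hδ : 0 ≤ δ)
    (hA : ∀ c, δ * ‖c‖ ≤ ‖A c‖) (h : W) :
    δ ^ 2 * ‖A.regularizedInverse t h‖ ≤ ‖A‖ * ‖h‖ := by
  have hle (c : V) : δ ^ 2 * ‖c‖ ^ 2 ≤ ‖A c‖ ^ 2 + t * ‖c‖ ^ 2 := by
    rw [← mul_pow]
    exact (pow_le_pow_left₀ (by positivity) (hA c) 2).trans (le_add_of_nonneg_right (by positivity))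
  have := norm_mul_le_norm_adjoint_comp_add_smul A (t := t) (A.regularizedInverse t h) (hle _)
  rw [adjoint_comp_add_smul_regularizedInverse A ht] at this
  exact this.trans (((adjoint A).le_opNorm h).trans_eq (by rw [LinearIsometryEquiv.norm_map]))

/-- `A†A + t` maps the error to `-t c`, so the failure to be a left inverse is of order `t`. -/
theorem norm_regularizedInverse_apply_sub_le (A : V →L[𝕜] W) {t δ : ℝ} (ht : 0 < t) (hδ : 0 ≤ δ)
    (hA : ∀ c, δ * ‖c‖ ≤ ‖A c‖) (c : V) :
    δ ^ 2 * ‖A.regularizedInverse t (A c) - c‖ ≤ t * ‖c‖ := by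
  have hle (c : V) : δ ^ 2 * ‖c‖ ^ 2 ≤ ‖A c‖ ^ 2 + t * ‖c‖ ^ 2 := by
    rw [← mul_pow]
    exact (pow_le_pow_left₀ (by positivity) (hA c) 2).trans (le_add_of_nonneg_right (by positivity))
  have := norm_mul_le_norm_adjoint_comp_add_smul A (t := t) (A.regularizedInverse t (A c) - c)
    (hle _)
  rw [map_sub, adjoint_comp_add_smul_regularizedInverse A ht] at this
  refine this.trans_eq ?_
  simp [norm_smul, abs_of_pos ht]

/-- Since `t x > 0`, the operator to be inverted is a unit even where `A x` is not injective. -/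
theorem ContinuousAt.regularizedInverse {X : Type*} [TopologicalSpace X] {A : X → V →L[𝕜] W}
    {t : X → ℝ} {x : X} (hA : ContinuousAt A x) (ht : ContinuousAt t x) (hx : 0 < t x) :
    ContinuousAt (fun x ↦ (A x).regularizedInverse (t x)) x := by
  have hadj : ContinuousAt (fun x ↦ adjoint (A x)) x :=
    (adjoint : (V →L[𝕜] W) ≃ₗᵢ⋆[𝕜] _).continuous.continuousAt.comp hA
  have hT : ContinuousAt (fun x ↦ adjoint (A x) ∘L A x + (t x : 𝕜) • (1 : V →L[𝕜] V)) x :=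
    (hadj.clm_comp hA).add
      (((RCLike.continuous_ofReal (K := 𝕜)).continuousAt.comp (f := t) ht).smul continuousAt_const)
  obtain ⟨u, hu⟩ := isUnit_adjoint_comp_add_smul (A x) hx
  have hinv : ContinuousAt Ring.inverse (adjoint (A x) ∘L A x + (t x : 𝕜) • (1 : V →L[𝕜] V)) :=
    hu ▸ NormedRing.inverse_continuousAt u
  exact (ContinuousAt.comp (f := fun x ↦ adjoint (A x) ∘L A x + (t x : 𝕜) • (1 : V →L[𝕜] V))
    hinv hT).clm_comp hadj

end RegularizedInverse

/-! ### Asymptotic values of the coordinates at the exceptional point -/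

section AsymptoticValue

variable {𝕜 : Type*} [RCLike 𝕜] {X : Type*} [MetricSpace X] {F : Type*} {E : X → Type*}
  [∀ x, NormedAddCommGroup (E x)] [∀ x, NormedSpace 𝕜 (E x)] [TopologicalSpace (TotalSpace F E)]
  {H : Type*} [NormedAddCommGroup H] [NormedSpace 𝕜 H] {ψ : ∀ x, E x →ₗ[𝕜] H} {C : ℝ} {o : X}

/-- The values of `ψ` at vectors near `e` over points `x ≠ o` are close to `a x`. -/
def IsAsymptoticValue (F : Type*) [TopologicalSpace (TotalSpace F E)] (ψ : ∀ x, E x →ₗ[𝕜] H)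
    (e : E o) (a : X → H) : Prop :=
  ∀ ε > 0, ∀ᶠ v : TotalSpace F E in 𝓝 ⟨o, e⟩, v.proj ≠ o → ‖a v.proj - ψ v.proj v.snd‖ < ε

theorem IsContinuousBanachBundle.isAsymptoticValue_zero (hE : IsContinuousBanachBundle 𝕜 F E)
    (hC : 0 < C) (hψ : ∀ x ≠ o, ∀ v, ‖ψ x v‖ ≤ C * ‖v‖) :
    IsAsymptoticValue F ψ (0 : E o) 0 := by
  intro ε hε
  filter_upwards [(isOpen_lt hE.continuous_norm (continuous_const (y := ε / C))).mem_nhds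
    (show ‖(0 : E o)‖ < ε / C by rw [norm_zero]; positivity)] with v hv hvo
  rw [Pi.zero_apply, zero_sub, norm_neg]
  exact (hψ _ hvo _).trans_lt ((lt_div_iff₀' hC).1 hv)

theorem IsAsymptoticValue.const_smul (hE : IsContinuousBanachBundle 𝕜 F E)
    (hC : 0 < C) (hψ : ∀ x ≠ o, ∀ v, ‖ψ x v‖ ≤ C * ‖v‖) {e : E o} {a : X → H}
    (h : IsAsymptoticValue F ψ e a) (c : 𝕜) : IsAsymptoticValue F ψ (c • e) (c • a) := by
  rcases eq_or_ne c 0 with rfl | hc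
  · simpa using hE.isAsymptoticValue_zero hC hψ
  intro ε hε
  have hcpos : 0 < ‖c‖ := norm_pos_iff.2 hc
  have ht : Tendsto (fun v ↦ ⟨v.proj, c⁻¹ • v.snd⟩ : TotalSpace F E → TotalSpace F E)
      (𝓝 ⟨o, c • e⟩) (𝓝 ⟨o, e⟩) := by
    have := (hE.continuous_const_smul c⁻¹).tendsto ⟨o, c • e⟩
    simpa [inv_smul_smul₀ hc] using this
  filter_upwards [ht.eventually (h (ε / ‖c‖) (by positivity))] with v hv hvo
  have h₁ := (lt_div_iff₀' hcpos).1 (hv hvo)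
  rwa [map_smul, ← norm_smul, smul_sub, smul_inv_smul₀ hc] at h₁

/-- A vector near `e + e'` is close in norm to a sum `w + w'` of vectors near `e` and `e'` in the
same fiber, and the uniform bound on `ψ` carries this closeness over to the values. -/
theorem IsAsymptoticValue.add (hE : IsContinuousBanachBundle 𝕜 F E)
    (hC : 0 < C) (hψ : ∀ x ≠ o, ∀ v, ‖ψ x v‖ ≤ C * ‖v‖) {e e' : E o} {a a' : X → H}
    (h : IsAsymptoticValue F ψ e a) (h' : IsAsymptoticValue F ψ e' a') :
    IsAsymptoticValue F ψ (e + e') (a + a') := by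
  intro ε hε
  obtain ⟨Z, hZ, hZd⟩ := hE.exists_nhds_norm_sub_lt (e + e') (ε := ε / 3 / C) (by positivity)
  obtain ⟨W, hW, W', hW', hadd⟩ := hE.exists_nhds_add_mem hZ
  filter_upwards [hZ,
    hE.eventually_proj _ (hE.eventually_exists_of_eventually
      ((eventually_mem_set.2 hW).and (h (ε / 3) (by positivity)))),
    hE.eventually_proj _ (hE.eventually_exists_of_eventually
      ((eventually_mem_set.2 hW').and (h' (ε / 3) (by positivity))))]
  rintro ⟨x, v⟩ hv ⟨w, hw, hwa⟩ ⟨w', hw', hwa'⟩ hx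
  have h₁ : ‖ψ x (w + w' - v)‖ < ε / 3 :=
    (hψ x hx _).trans_lt ((lt_div_iff₀' hC).1 (hZd x _ _ (hadd x w w' hw hw') hv))
  have h₂ : (a + a') x - ψ x v = (a x - ψ x w) + (a' x - ψ x w') + ψ x (w + w' - v) := by
    rw [map_sub, map_add, Pi.add_apply]; abel
  show ‖(a + a') x - ψ x v‖ < ε
  rw [h₂]
  refine (norm_add₃_le).trans_lt ?_
  linarith [hwa hx, hwa' hx]

theorem IsAsymptoticValue.sum_smul (hE : IsContinuousBanachBundle 𝕜 F E)
    (hC : 0 < C) (hψ : ∀ x ≠ o, ∀ v, ‖ψ x v‖ ≤ C * ‖v‖) {ι : Type*} (s : Finset ι) {e : ι → E o}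
    {a : ι → X → H} (h : ∀ i, IsAsymptoticValue F ψ (e i) (a i)) (c : ι → 𝕜) :
    IsAsymptoticValue F ψ (∑ i ∈ s, c i • e i) (∑ i ∈ s, c i • a i) := by
  classical
  induction s using Finset.induction_on with
  | empty => simpa using hE.isAsymptoticValue_zero hC hψ
  | insert i s hi ih =>
    rw [Finset.sum_insert hi, Finset.sum_insert hi]
    exact ((h i).const_smul hE hC hψ (c i)).add hE hC hψ ih

/-- Take shrinking neighborhoods `W n` of `e` whose intersections with fibers have diameter at most
`1 / (n + 1)`, and radii `r n` within which every fiber meets `W n`. Condition `n`, active when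
`dist x o ≤ r n`, asks that `a x` be within `2 * C / (n + 1)` of `ψ` on `W n`. The conditions are
convex and locally solvable by constants, hence have a continuous solution off `o`. -/
theorem IsContinuousBanachBundle.exists_isAsymptoticValue (hE : IsContinuousBanachBundle 𝕜 F E)
    [NormedSpace ℝ H] (hC : 0 < C) (hψ : ∀ x ≠ o, ∀ v, ‖ψ x v‖ ≤ C * ‖v‖)
    (hψc : ∀ v : TotalSpace F E, v.proj ≠ o →
      ContinuousAt (fun v : TotalSpace F E ↦ ψ v.proj v.snd) v) (e : E o) :
    ∃ a : X → H, (∀ x ≠ o, ContinuousAt a x) ∧ IsAsymptoticValue F ψ e a := by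
  classical
  choose W' hW' hd using fun n : ℕ ↦
    hE.exists_nhds_norm_sub_lt e (ε := 1 / ((n : ℝ) + 1)) (by positivity)
  let W (n : ℕ) : Set (TotalSpace F E) := ⋂ i ∈ Finset.range (n + 1), interior (W' i)
  have hWo (n) : IsOpen (W n) := isOpen_biInter_finset fun i _ ↦ isOpen_interior
  have hWe (n) : ⟨o, e⟩ ∈ W n := Set.mem_iInter₂.2 fun i _ ↦ mem_interior_iff_mem_nhds.2 (hW' i)
  have hWm {m n : ℕ} (hmn : m ≤ n) : W n ⊆ W m := by
    refine Set.biInter_subset_biInter_left fun i hi ↦ ?_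
    exact Finset.range_mono (by omega) hi
  have hWd (n x) (v w : E x) (hv : ⟨x, v⟩ ∈ W n) (hw : ⟨x, w⟩ ∈ W n) :
      ‖v - w‖ < 1 / ((n : ℝ) + 1) := by
    have hn : n ∈ Finset.range (n + 1) := Finset.self_mem_range_succ n
    exact hd n x v w (interior_subset (Set.mem_iInter₂.1 hv n hn))
      (interior_subset (Set.mem_iInter₂.1 hw n hn))
  -- The bound `r n ≤ 1 / (n + 1)` makes only finitely many conditions active at a given point other
  -- than `o`.
  have hr (n : ℕ) : ∃ r > 0, r ≤ 1 / ((n : ℝ) + 1) ∧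
      ∀ x, dist x o ≤ r → ∃ v : E x, ⟨x, v⟩ ∈ W n := by
    have := hE.eventually_exists_of_eventually (eventually_mem_set.2 ((hWo n).mem_nhds (hWe n)))
    obtain ⟨r, hr, h⟩ := Metric.nhds_basis_closedBall.mem_iff.1 this
    exact ⟨min r (1 / ((n : ℝ) + 1)), lt_min hr (by positivity), min_le_right _ _,
      fun x hx ↦ h (hx.trans (min_le_left _ _))⟩
  choose r hr₀ hrle hrW using hr
  let t (y : {x // x ≠ o}) : Set H :=
    ⋂ (n : ℕ) (_ : dist (y : X) o ≤ r n) (w : E y) (_ : (⟨y, w⟩ : TotalSpace F E) ∈ W n),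
      Metric.closedBall (ψ y w) (2 * C / ((n : ℝ) + 1))
  have ht {y : {x // x ≠ o}} {a : H} : a ∈ t y ↔ ∀ n : ℕ, dist (y : X) o ≤ r n → ∀ w : E y,
      (⟨y, w⟩ : TotalSpace F E) ∈ W n → dist a (ψ y w) ≤ 2 * C / ((n : ℝ) + 1) := by
    simp [t]
  obtain ⟨g, hg⟩ : ∃ g : C({x // x ≠ o}, H), ∀ y, g y ∈ t y := by
    refine exists_continuous_forall_mem_convex_of_local_const
      (fun y ↦ convex_iInter fun n ↦ convex_iInter fun _ ↦ convex_iInter fun w ↦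
        convex_iInter fun _ ↦ convex_closedBall _ _) fun y₀ ↦ ?_
    have hD : 0 < dist (y₀ : X) o := dist_pos.2 y₀.2
    obtain ⟨M, hM⟩ := exists_nat_one_div_lt (half_pos hD)
    have hrM {n : ℕ} (hn : M ≤ n) : r n < dist (y₀ : X) o / 2 :=
      (hrle n).trans_lt ((Nat.one_div_le_one_div hn).trans_lt hM)
    have hdc : Continuous fun y : {x // x ≠ o} ↦ dist (y : X) o :=
      continuous_subtype_val.dist continuous_const
    -- No new condition becomes active near `y₀`: those with `n ≥ M` are inactive there, and each of
    -- the others is inactive on an open set.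
    have hev : ∀ᶠ y : {x // x ≠ o} in 𝓝 y₀, ∀ n, dist (y : X) o ≤ r n → dist (y₀ : X) o ≤ r n := by
      have h₁ : ∀ᶠ y : {x // x ≠ o} in 𝓝 y₀, dist (y₀ : X) o / 2 < dist (y : X) o :=
        hdc.continuousAt.eventually (lt_mem_nhds (half_lt_self hD))
      have h₂ : ∀ᶠ y : {x // x ≠ o} in 𝓝 y₀, ∀ n ∈ Finset.range M,
          dist (y : X) o ≤ r n → dist (y₀ : X) o ≤ r n := by
        refine (eventually_all_finset _).2 fun n _ ↦ ?_
        by_cases hn : dist (y₀ : X) o ≤ r n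
        · exact Eventually.of_forall fun _ _ ↦ hn
        · filter_upwards [hdc.continuousAt.eventually (lt_mem_nhds (not_le.1 hn))] with y hy hy'
          exact absurd hy' hy.not_ge
      filter_upwards [h₁, h₂] with y hy₁ hy₂ n hn
      by_cases hnM : n < M
      · exact hy₂ n (Finset.mem_range.2 hnM) hn
      · linarith [hrM (not_lt.1 hnM)]
    by_cases hP : ∃ n, dist (y₀ : X) o ≤ r n
    · have hPM {n : ℕ} (hn : dist (y₀ : X) o ≤ r n) : n ≤ M := by
        by_contra h
        linarith [hrM (not_le.1 h).le]
      obtain ⟨m, hm⟩ := hP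
      -- As the `W n` decrease, a vector `w₀` in `W k` for the last active index serves all active
      -- conditions. One half of `2 * C / (n + 1)` pays for the diameter of `W n` in a fiber, the
      -- other for the variation of `ψ` near `w₀`.
      let k := Nat.findGreatest (fun n ↦ dist (y₀ : X) o ≤ r n) M
      have hk : dist (y₀ : X) o ≤ r k :=
        Nat.findGreatest_spec (P := fun n ↦ dist (y₀ : X) o ≤ r n) (hPM hm) hm
      have hkmax {n : ℕ} (hn : dist (y₀ : X) o ≤ r n) : n ≤ k :=
        Nat.le_findGreatest (hPM hn) hn
      obtain ⟨w₀, hw₀⟩ := hrW k y₀ hk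
      refine ⟨ψ y₀ w₀, ?_⟩
      have h₁ : ∀ᶠ v : TotalSpace F E in 𝓝 ⟨y₀, w₀⟩, v ∈ W k ∧
          dist (ψ v.proj v.snd) (ψ y₀ w₀) < C / ((k : ℝ) + 1) :=
        (eventually_mem_set.2 ((hWo k).mem_nhds hw₀)).and
          (Metric.tendsto_nhds.1 (hψc ⟨y₀, w₀⟩ y₀.2) _ (by positivity))
      filter_upwards [hev, continuous_subtype_val.continuousAt.eventually
        (hE.eventually_exists_of_eventually h₁)] with y hy hyw
      obtain ⟨w, hwW, hwd⟩ := hyw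
      refine ht.2 fun n hn w' hw' ↦ ?_
      have hnk : n ≤ k := hkmax (hy n hn)
      have h₂ : dist (ψ y w) (ψ y w') ≤ C * (1 / ((n : ℝ) + 1)) := by
        rw [dist_eq_norm, ← map_sub]
        refine (hψ y y.2 _).trans ?_
        gcongr
        exact (hWd n y w w' (hWm hnk hwW) hw').le
      have h₃ : C / ((k : ℝ) + 1) ≤ C / ((n : ℝ) + 1) := by gcongr
      have h₄ : 2 * C / ((n : ℝ) + 1) = C / ((n : ℝ) + 1) + C * (1 / ((n : ℝ) + 1)) := by ring
      rw [h₄]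
      exact (dist_triangle_left _ _ (ψ y w)).trans (add_le_add (hwd.le.trans h₃) h₂)
    · refine ⟨0, ?_⟩
      filter_upwards [hev] with y hy
      exact ht.2 fun n hn ↦ absurd ⟨n, hy n hn⟩ hP
  refine ⟨fun x ↦ if h : x ≠ o then g ⟨x, h⟩ else 0, fun x hx ↦ ?_, fun ε hε ↦ ?_⟩
  · refine ContinuousOn.continuousAt (s := {x | x ≠ o})
      (continuousOn_iff_continuous_domRestrict.2 ?_) (isOpen_ne.mem_nhds hx)
    refine g.continuous.congr fun y ↦ ?_
    have hy : (y : X) ≠ o := y.2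
    rw [Set.domRestrict_apply, dif_pos hy]
  · obtain ⟨n, hn⟩ := exists_nat_one_div_lt (show 0 < ε / (2 * C) by positivity)
    filter_upwards [(hWo n).mem_nhds (hWe n),
      hE.eventually_proj e (Metric.closedBall_mem_nhds o (hr₀ n))] with v hv hvr hvo
    rw [dif_pos hvo, ← dist_eq_norm]
    refine (ht.1 (hg ⟨v.proj, hvo⟩) n hvr v.snd hv).trans_lt ?_
    rw [lt_div_iff₀ (by positivity)] at hn
    calc _ = 1 / ((n : ℝ) + 1) * (2 * C) := by ring
      _ < ε := hn

end AsymptoticValue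

/-! ### Linear maps describing the coordinates near the exceptional fiber -/

section Embedding

variable {𝕜 : Type*} [RCLike 𝕜] {X : Type*} [MetricSpace X] {F : Type*} {E : X → Type*}
  [∀ x, NormedAddCommGroup (E x)] [∀ x, NormedSpace 𝕜 (E x)] [TopologicalSpace (TotalSpace F E)]
  {o : X}

/-- Asymptotic values of `ψ` along a basis of a fiber assemble into linear maps, which are uniformly
bounded above and below near that fiber. -/
theorem IsContinuousBanachBundle.exists_asymptotic_linearMap (hE : IsContinuousBanachBundle 𝕜 F E)
    {H : Type*} [NormedAddCommGroup H] [NormedSpace 𝕜 H] [NormedSpace ℝ H]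
    {ψ : ∀ x, E x →ₗ[𝕜] H} {C : ℝ} (hC : 0 < C)
    (hψ : ∀ x ≠ o, ∀ v, ‖ψ x v‖ ≤ C * ‖v‖ ∧ ‖v‖ ≤ C * ‖ψ x v‖)
    (hψc : ∀ v : TotalSpace F E, v.proj ≠ o →
      ContinuousAt (fun v : TotalSpace F E ↦ ψ v.proj v.snd) v)
    {m : ℕ} (b : EuclideanSpace 𝕜 (Fin m) ≃L[𝕜] E o) :
    ∃ A : X → EuclideanSpace 𝕜 (Fin m) →L[𝕜] H, (∀ x ≠ o, ContinuousAt A x) ∧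
      (∀ c, IsAsymptoticValue F ψ (b c) fun x ↦ A x c) ∧
      ∃ K > 0, ∃ δ > 0, ∀ᶠ x in 𝓝 o, x ≠ o → ‖A x‖ ≤ K ∧ ∀ c, δ * ‖c‖ ≤ ‖A x c‖ := by
  have : ProperSpace (EuclideanSpace 𝕜 (Fin m)) := FiniteDimensional.proper_rclike 𝕜 _
  choose a hac ha using fun i ↦
    hE.exists_isAsymptoticValue hC (fun x hx v ↦ (hψ x hx v).1) hψc (b (EuclideanSpace.single i 1))
  let A (x : X) : EuclideanSpace 𝕜 (Fin m) →L[𝕜] H :=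
    ∑ i, (EuclideanSpace.proj i : EuclideanSpace 𝕜 (Fin m) →L[𝕜] 𝕜).smulRight (a i x)
  have hA (x c) : A x c = ∑ i, c i • a i x := by simp [A]
  have hAc (x) (hx : x ≠ o) : ContinuousAt A x := by
    refine tendsto_finsetSum _ fun i _ ↦ ?_
    exact (ContinuousLinearMap.smulRightL 𝕜 _ _ (EuclideanSpace.proj i)).continuous.continuousAt
      |>.comp (hac i x hx)
  have hAa (c : EuclideanSpace 𝕜 (Fin m)) : IsAsymptoticValue F ψ (b c) fun x ↦ A x c := by
    have h := IsAsymptoticValue.sum_smul hE hC (fun x hx v ↦ (hψ x hx v).1) Finset.univ ha c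
    have hc : c = ∑ i, c i • EuclideanSpace.single i (1 : 𝕜) := by
      ext j; simp [Finset.sum_apply, Pi.single_apply]
    have h₁ : ∑ i, c i • b (EuclideanSpace.single i (1 : 𝕜)) = b c := by
      conv_rhs => rw [hc]
      simp only [map_sum, map_smul]
    have h₂ : ∑ i, c i • a i = fun x ↦ A x c := by
      ext x; simp [hA]
    rwa [h₁, h₂] at h
  have hbound (i) : ∃ k : ℝ, 0 ≤ k ∧ ∀ᶠ x in 𝓝 o, x ≠ o → ‖a i x‖ ≤ k := by
    set e := b (EuclideanSpace.single i 1) with he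
    refine ⟨1 + C * (‖e‖ + 1), by positivity, ?_⟩
    have h₁ : ∀ᶠ v : TotalSpace F E in 𝓝 ⟨o, e⟩, ‖v.snd‖ < ‖e‖ + 1 :=
      (isOpen_lt hE.continuous_norm continuous_const).mem_nhds (lt_add_one ‖e‖)
    filter_upwards [hE.eventually_exists_of_eventually (h₁.and (ha i 1 one_pos))]
    rintro x ⟨v, hv, hav⟩ hx
    calc ‖a i x‖ = ‖(a i x - ψ x v) + ψ x v‖ := by rw [sub_add_cancel]
      _ ≤ 1 + C * (‖e‖ + 1) := (norm_add_le _ _).trans (add_le_add (hav hx).le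
          ((hψ x hx v).1.trans (by have : ‖v‖ ≤ ‖e‖ + 1 := hv.le; gcongr)))
  choose k hk₀ hk using hbound
  let K : ℝ := ∑ i, k i + 1
  have hK₀ : 0 < K := add_pos_of_nonneg_of_pos (Finset.sum_nonneg fun i _ ↦ hk₀ i) one_pos
  have hK : ∀ᶠ x in 𝓝 o, x ≠ o → ‖A x‖ ≤ K := by
    filter_upwards [eventually_all.2 hk] with x hx hxo
    refine ContinuousLinearMap.opNorm_le_bound _ hK₀.le fun c ↦ ?_
    rw [hA]
    calc ‖∑ i, c i • a i x‖ ≤ ∑ i, k i * ‖c‖ := norm_sum_le_of_le _ fun i _ ↦ by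
          rw [norm_smul, mul_comm]
          exact mul_le_mul (hx i hxo) (PiLp.norm_apply_le c i) (norm_nonneg _) (hk₀ i)
      _ ≤ K * ‖c‖ := by
          rw [← Finset.sum_mul]
          exact mul_le_mul_of_nonneg_right (le_add_of_nonneg_right zero_le_one) (norm_nonneg _)
  let μ : ℝ := ‖(b.symm : E o →L[𝕜] EuclideanSpace 𝕜 (Fin m))‖ + 1
  have hμ : 0 < μ := by positivity
  have hbμ (c : EuclideanSpace 𝕜 (Fin m)) : ‖c‖ ≤ μ * ‖b c‖ := by
    have h := (b.symm : E o →L[𝕜] EuclideanSpace 𝕜 (Fin m)).le_opNorm (b c)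
    rw [ContinuousLinearEquiv.coe_coe, b.symm_apply_apply] at h
    exact h.trans (mul_le_mul_of_nonneg_right (le_add_of_nonneg_right zero_le_one) (norm_nonneg _))
  -- For `‖c‖ = 1`, vectors near `b c` have norm above `1 / (2 * μ)`, hence `ψ`-value at least `4 *
  -- δ`. Passing to `A x c` costs `2 * δ`, and passing from single `c` to the whole sphere costs
  -- another `δ`.
  let δ : ℝ := 1 / (8 * μ * C)
  have hδ : 0 < δ := by positivity
  have hpt (c : EuclideanSpace 𝕜 (Fin m)) (hc : ‖c‖ = 1) :
      ∀ᶠ x in 𝓝 o, x ≠ o → 2 * δ ≤ ‖A x c‖ := by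
    have hbc : 1 / (2 * μ) < ‖b c‖ := by
      have := hbμ c
      rw [hc] at this
      rw [div_lt_iff₀ (by positivity)]
      linarith
    have h₁ : ∀ᶠ v : TotalSpace F E in 𝓝 ⟨o, b c⟩, 1 / (2 * μ) < ‖v.snd‖ :=
      (isOpen_lt continuous_const hE.continuous_norm).mem_nhds hbc
    filter_upwards [hE.eventually_exists_of_eventually (h₁.and (hAa c (2 * δ) (by positivity)))]
    rintro x ⟨v, hv, hav⟩ hx
    have h₂ : ‖ψ x v‖ ≤ ‖A x c‖ + ‖A x c - ψ x v‖ := by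
      have := norm_sub_le (A x c) (A x c - ψ x v)
      rwa [sub_sub_cancel] at this
    have h₃ : 4 * δ ≤ ‖ψ x v‖ := by
      have h := hv.le.trans (hψ x hx v).2
      calc 4 * δ = 1 / (2 * μ) / C := by simp only [δ]; field_simp; norm_num
        _ ≤ ‖ψ x v‖ := (div_le_iff₀' hC).2 h
    have h₄ : ‖A x c - ψ x v‖ < 2 * δ := hav hx
    linarith
  have hsphere : ∀ᶠ x in 𝓝 o, ∀ c ∈ Metric.sphere (0 : EuclideanSpace 𝕜 (Fin m)) 1,
      x ≠ o → δ ≤ ‖A x c‖ := by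
    -- The bound `‖A x‖ ≤ K` makes the `A x` equicontinuous, so the estimate at `c` spreads to the
    -- ball of radius `δ / K` about `c`, uniformly in `x`.
    refine (isCompact_sphere _ _).eventually_forall_of_forall_eventually fun c hc ↦ ?_
    have hnear : ∀ᶠ c' in 𝓝 c, dist c' c < δ / K := Metric.ball_mem_nhds _ (by positivity)
    rw [nhds_prod_eq]
    filter_upwards [((hpt c (by simpa using hc)).and hK).prod_mk hnear]
    rintro ⟨x, c'⟩ ⟨⟨h₁, h₂⟩, h₃⟩ hx
    have h₄ : ‖A x (c - c')‖ ≤ δ := by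
      refine ((A x).le_of_opNorm_le (h₂ hx) _).trans ?_
      rw [← dist_eq_norm, dist_comm]
      exact ((lt_div_iff₀' hK₀).1 h₃).le
    have h₅ : ‖A x c‖ ≤ ‖A x c'‖ + ‖A x (c - c')‖ := by
      rw [map_sub]
      simpa using norm_add_le (A x c') (A x c - A x c')
    have := h₁ hx
    show δ ≤ ‖A x c'‖
    linarith
  refine ⟨A, hAc, hAa, K, hK₀, δ, hδ, ?_⟩
  filter_upwards [hK, hsphere] with x hxK hxδ hx
  refine ⟨hxK hx, fun c ↦ ?_⟩
  rcases eq_or_ne c 0 with rfl | hc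
  · simp
  have hc' : 0 < ‖c‖ := norm_pos_iff.2 hc
  have h := hxδ (((‖c‖ : 𝕜)⁻¹) • c) (by simp [norm_smul, hc'.ne']) hx
  rwa [map_smul, norm_smul, norm_inv, RCLike.norm_ofReal, abs_norm, inv_mul_eq_div,
    le_div_iff₀ hc'] at h

end Embedding

/-! ### Construction of the embedding -/

section Embedding

variable {𝕜 : Type*} [RCLike 𝕜] {X : Type*} [MetricSpace X] {F : Type*} {E : X → Type*}
  [∀ x, NormedAddCommGroup (E x)] [∀ x, NormedSpace 𝕜 (E x)] [TopologicalSpace (TotalSpace F E)]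
  {o : X}

/-- A continuous Banach bundle over a metric space embeds into a trivial bundle of finite rank if it
is of finite type away from one point and its fiber at that point is finite-dimensional. -/
theorem IsContinuousBanachBundle.exists_isBundleEmbedding (hE : IsContinuousBanachBundle 𝕜 F E)
    [FiniteDimensional 𝕜 (E o)] (hfin : IsFiniteTypeOver 𝕜 F E {x | x ≠ o}) :
    ∃ (N : ℕ) (φ : ∀ x, E x →ₗ[𝕜] EuclideanSpace 𝕜 (Fin N)),
      IsBundleEmbedding 𝕜 F E (EuclideanSpace 𝕜 (Fin N))
        (Bundle.Trivial X (EuclideanSpace 𝕜 (Fin N))) φ := by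
  obtain ⟨n, C, hC, ψ, hψ, hψc⟩ := hE.exists_uniform_coordinates_of_isFiniteTypeOver hfin
    fun h ↦ (h ▸ Set.mem_univ o : o ∈ {x | x ≠ o}) rfl
  let V := EuclideanSpace 𝕜 (Fin (Module.finrank 𝕜 (E o)))
  let H := EuclideanSpace 𝕜 (Fin n)
  let b : V ≃L[𝕜] E o := ContinuousLinearEquiv.ofFinrankEq finrank_euclideanSpace_fin
  obtain ⟨A, hAc, hAa, K, hK, δ, hδ, hA⟩ := hE.exists_asymptotic_linearMap hC hψ hψc b
  -- The parameter `dist x o` is positive off `o`, which keeps `R` continuous where `A x` fails to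
  -- be injective, and tends to 0 at `o`, which makes `R x` asymptotically a left inverse of `A x`.
  let R (x : X) : H →L[𝕜] V := (A x).regularizedInverse (dist x o)
  have hRc (x) (hx : x ≠ o) : ContinuousAt R x :=
    (hAc x hx).regularizedInverse (continuous_id.dist continuous_const).continuousAt (dist_pos.2 hx)
  let Φ' (x : X) : E x →ₗ[𝕜] V × H :=
    LinearMap.prod ((R x : H →ₗ[𝕜] V) ∘ₗ ψ x)
      (ψ x - (A x : V →ₗ[𝕜] H) ∘ₗ (R x : H →ₗ[𝕜] V) ∘ₗ ψ x)
  obtain ⟨Φ, hΦo, hΦ⟩ : ∃ Φ : ∀ x, E x →ₗ[𝕜] V × H, (∀ v, Φ o v = (b.symm v, 0)) ∧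
      ∀ x ≠ o, ∀ v, Φ x v = (R x (ψ x v), ψ x v - A x (R x (ψ x v))) := by
    classical
    refine ⟨Function.update Φ' o (LinearMap.prod b.symm.toLinearEquiv.toLinearMap 0),
      fun v ↦ ?_, fun x hx v ↦ ?_⟩
    · rw [Function.update_self]; rfl
    · rw [Function.update_of_ne hx]; rfl
  have hΦc : Continuous fun v : TotalSpace F E ↦ Φ v.proj v.snd := by
    refine continuous_iff_continuousAt.2 fun ⟨x, e⟩ ↦ ?_
    rcases eq_or_ne x o with rfl | hx
    · obtain ⟨c, rfl⟩ := b.surjective e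
      refine Metric.tendsto_nhds.2 fun ε hε ↦ ?_
      -- Chosen so that `(1 + K) * ε' = ε / 2`. The number `η` bounds both `‖ψ v - A c‖` and the
      -- regularization parameter, so `‖R ψ v - c‖` is at most `η * (K + ‖c‖) / δ ^ 2 ≤ ε'`.
      let ε' : ℝ := ε / (2 * (1 + K))
      have hε' : 0 < ε' := by positivity
      let η : ℝ := min (ε / 2) (δ ^ 2 * ε' / (K + ‖c‖))
      have hη : 0 < η := lt_min (by positivity) (by positivity)
      have hη₂ : η * (K + ‖c‖) ≤ δ ^ 2 * ε' :=
        (le_div_iff₀ (by positivity)).1 (min_le_right _ _)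
      let μ : ℝ := ‖(b.symm : E x →L[𝕜] V)‖ + 1
      have hμ : 0 < μ := by positivity
      obtain ⟨W, hW, hWd⟩ := hE.exists_nhds_norm_sub_lt (b c) (ε := ε / μ) (by positivity)
      filter_upwards [hW, hAa c η hη, hE.eventually_proj (b c) hA,
        hE.eventually_proj (b c) (Metric.ball_mem_nhds x hη)]
      rintro ⟨y, v⟩ hvW hvA hyA hyd
      show dist (Φ y v) (Φ x (b c)) < ε
      rw [hΦo, b.symm_apply_apply]
      -- Here `x` is the exceptional point. Neighborhoods of `b c` also contain vectors of its own
      -- fiber, where continuity of `b.symm` is what counts.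
      rcases eq_or_ne y x with rfl | hy
      · rw [hΦo, Prod.dist_eq, dist_self, max_lt_iff, dist_eq_norm]
        refine ⟨?_, hε⟩
        have h₁ := (b.symm : E y →L[𝕜] V).le_opNorm (v - b c)
        rw [ContinuousLinearEquiv.coe_coe, map_sub, b.symm_apply_apply] at h₁
        refine h₁.trans_lt ?_
        calc _ ≤ μ * ‖v - b c‖ :=
              mul_le_mul_of_nonneg_right (le_add_of_nonneg_right zero_le_one) (norm_nonneg _)
          _ < ε := (lt_div_iff₀' hμ).1 (hWd y v (b c) hvW (mem_of_mem_nhds hW))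
      · obtain ⟨hAK, hAδ⟩ := hyA hy
        have ht : 0 < dist y x := dist_pos.2 hy
        set h := ψ y v
        have hh : ‖h - A y c‖ < η := by rw [norm_sub_rev]; exact hvA hy
        have h₁ : δ ^ 2 * ‖R y (h - A y c)‖ ≤ K * η :=
          (norm_regularizedInverse_le (A y) ht hδ.le hAδ _).trans
            (mul_le_mul hAK hh.le (norm_nonneg _) hK.le)
        have h₂ : δ ^ 2 * ‖R y (A y c) - c‖ ≤ η * ‖c‖ :=
          (norm_regularizedInverse_apply_sub_le (A y) ht hδ.le hAδ c).trans
            (mul_le_mul_of_nonneg_right (le_of_lt hyd) (norm_nonneg _))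
        have h₃ : ‖R y h - c‖ ≤ ε' := by
          have heq : R y h - c = R y (h - A y c) + (R y (A y c) - c) := by
            rw [map_sub]; abel
          have h₄ : ‖R y h - c‖ ≤ ‖R y (h - A y c)‖ + ‖R y (A y c) - c‖ := by
            rw [heq]; exact norm_add_le _ _
          refine le_of_mul_le_mul_left ?_ (pow_pos hδ 2)
          calc δ ^ 2 * ‖R y h - c‖ ≤ δ ^ 2 * (‖R y (h - A y c)‖ + ‖R y (A y c) - c‖) := by gcongr
            _ ≤ η * (K + ‖c‖) := by linarith
            _ ≤ δ ^ 2 * ε' := hη₂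
        have hεε : ε' + K * ε' = ε / 2 := by simp only [ε']; field_simp
        rw [hΦ y hy, Prod.dist_eq, max_lt_iff, dist_eq_norm, dist_zero_right]
        have hKε : 0 < K * ε' := by positivity
        refine ⟨by linarith, ?_⟩
        have heq : h - A y (R y h) = (h - A y c) - A y (R y h - c) := by
          rw [map_sub]; abel
        calc ‖h - A y (R y h)‖ ≤ ‖h - A y c‖ + ‖A y (R y h - c)‖ := by
              rw [heq]; exact norm_sub_le _ _
          _ < ε / 2 + K * ε' := add_lt_add_of_lt_of_le (hh.trans_le (min_le_left _ _))
              (((A y).le_of_opNorm_le hAK _).trans (by gcongr))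
          _ ≤ ε := by linarith
    · have hp : ContinuousAt (TotalSpace.proj : TotalSpace F E → X) ⟨x, e⟩ :=
        hE.continuous_proj.continuousAt
      have hR : ContinuousAt (fun v : TotalSpace F E ↦ R v.proj) ⟨x, e⟩ :=
        ContinuousAt.comp (g := R) (f := TotalSpace.proj) (x := ⟨x, e⟩) (hRc x hx) hp
      have hA' : ContinuousAt (fun v : TotalSpace F E ↦ A v.proj) ⟨x, e⟩ :=
        ContinuousAt.comp (g := A) (f := TotalSpace.proj) (x := ⟨x, e⟩) (hAc x hx) hp
      have hv := hψc ⟨x, e⟩ hx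
      refine ((hR.clm_apply hv).prodMk (hv.sub (hA'.clm_apply (hR.clm_apply hv)))).congr ?_
      filter_upwards [hE.eventually_proj e (isOpen_ne.mem_nhds hx)] with v hv
      exact (hΦ _ hv _).symm
  have hΦb (x) : ∃ K > 0, ∀ᶠ y in 𝓝 x, ∀ v : E y, ‖v‖ ≤ K * ‖Φ y v‖ := by
    obtain ⟨k, hk, hAk⟩ : ∃ k > 0, ∀ᶠ y in 𝓝 x, y ≠ o → ‖A y‖ ≤ k := by
      rcases eq_or_ne x o with rfl | hx
      · exact ⟨K, hK, hA.mono fun y h hy ↦ (h hy).1⟩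
      · refine ⟨‖A x‖ + 1, by positivity, ?_⟩
        filter_upwards [(hAc x hx).norm.eventually (gt_mem_nhds (lt_add_one ‖A x‖))] with y hy _
        exact hy.le
    -- The first summand serves the fibers off `o`, where `ψ v` is the second component of `Φ` plus
    -- `A` of the first; the second summand serves the fiber over `o`.
    refine ⟨C * (1 + k) + ‖(b : V →L[𝕜] E o)‖, by positivity, ?_⟩
    filter_upwards [hAk] with y hy v
    rw [add_mul]
    rcases eq_or_ne y o with rfl | hyo
    · refine le_add_of_nonneg_of_le (by positivity) ?_
      have h := (b : V →L[𝕜] E y).le_opNorm (b.symm v)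
      rw [ContinuousLinearEquiv.coe_coe, b.apply_symm_apply] at h
      refine h.trans (mul_le_mul_of_nonneg_left ?_ (norm_nonneg _))
      rw [hΦo]
      exact norm_fst_le (b.symm v, (0 : H))
    · refine le_add_of_le_of_nonneg ?_ (by positivity)
      have h₁ : ‖R y (ψ y v)‖ ≤ ‖Φ y v‖ := by rw [hΦ y hyo]; exact norm_fst_le (_, _)
      have h₂ : ‖ψ y v - A y (R y (ψ y v))‖ ≤ ‖Φ y v‖ := by rw [hΦ y hyo]; exact norm_snd_le (_, _)
      have h₃ : ‖A y (R y (ψ y v))‖ ≤ k * ‖Φ y v‖ :=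
        ((A y).le_of_opNorm_le (hy hyo) _).trans (by gcongr)
      have h₄ : ‖ψ y v‖ ≤ ‖ψ y v - A y (R y (ψ y v))‖ + ‖A y (R y (ψ y v))‖ := by
        simpa using norm_add_le (ψ y v - A y (R y (ψ y v))) (A y (R y (ψ y v)))
      calc ‖v‖ ≤ C * ‖ψ y v‖ := (hψ y hyo v).2
        _ ≤ C * ((1 + k) * ‖Φ y v‖) := by gcongr; linarith
        _ = C * (1 + k) * ‖Φ y v‖ := (mul_assoc _ _ _).symm
  let N := Module.finrank 𝕜 (V × H)
  let T : (V × H) ≃L[𝕜] EuclideanSpace 𝕜 (Fin N) :=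
    ContinuousLinearEquiv.ofFinrankEq finrank_euclideanSpace_fin.symm
  let D : ℝ := ‖(T.symm : EuclideanSpace 𝕜 (Fin N) →L[𝕜] V × H)‖ + 1
  have hD (p : V × H) : ‖p‖ ≤ D * ‖T p‖ := by
    have h := (T.symm : EuclideanSpace 𝕜 (Fin N) →L[𝕜] V × H).le_opNorm (T p)
    rw [ContinuousLinearEquiv.coe_coe, T.symm_apply_apply] at h
    exact h.trans (mul_le_mul_of_nonneg_right (le_add_of_nonneg_right zero_le_one) (norm_nonneg _))
  refine ⟨N, fun x ↦ T.toLinearEquiv.toLinearMap ∘ₗ Φ x,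
    hE.isBundleEmbedding_of_bounded_below _ (T.continuous.comp hΦc) fun x ↦ ?_⟩
  obtain ⟨k, hk, h⟩ := hΦb x
  refine ⟨k * D, by positivity, h.mono fun y hy v ↦ ?_⟩
  calc ‖v‖ ≤ k * ‖Φ y v‖ := hy v
    _ ≤ k * (D * ‖T (Φ y v)‖) := by gcongr; exact hD _
    _ = k * D * ‖T (Φ y v)‖ := (mul_assoc _ _ _).symm

end Embedding

theorem mainTheorem11 {𝕜 : Type*} [RCLike 𝕜] (d : ℕ) {F : Type*} {E : UnitBall d → Type*}
    [∀ x, NormedAddCommGroup (E x)] [∀ x, NormedSpace 𝕜 (E x)]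
    [TopologicalSpace (Bundle.TotalSpace F E)]
    (hE : IsContinuousBanachBundle 𝕜 F E)
    (hsub : IsSubhomogeneous 𝕜 E)
    (hjump : ∀ x ∈ puncturedBall d, ∀ y ∈ puncturedBall d,
      Module.finrank 𝕜 (E x) = Module.finrank 𝕜 (E y))
    (hfin : IsFiniteTypeOver 𝕜 F E (puncturedBall d)) :
    ∃ (N : ℕ) (φ : ∀ x, E x →ₗ[𝕜] Bundle.Trivial (UnitBall d) (EuclideanSpace 𝕜 (Fin N)) x),
      IsBundleEmbedding 𝕜 F E (EuclideanSpace 𝕜 (Fin N))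
        (Bundle.Trivial (UnitBall d) (EuclideanSpace 𝕜 (Fin N))) φ := by
  let o : UnitBall d := ⟨0, Metric.mem_closedBall_self zero_le_one⟩
  obtain ⟨_, hdim⟩ := hsub
  have : FiniteDimensional 𝕜 (E o) := (hdim o).1
  have hS : puncturedBall d = {x | x ≠ o} := by
    ext x
    exact not_congr (Subtype.ext_iff (a1 := x) (a2 := o)).symm
  exact hE.exists_isBundleEmbedding (o := o) (hS ▸ hfin)
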